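/- Let $n,m\ge 1$, $d,p\ge 0$. For every multi-index $i\in\mathbb N^m$ with $|i|=i_1+\dots+i_m\le d$ let $f_i:(\mathbb C^n,0)\to(\mathbb C^n,0)$ be a germ of holomorphic map with $f_i(z)=\mathcal O(z^2)$, and let $A\in GL_n(\mathbb C)$ have non-resonant eigenvalues $\lambda_1,\dots,\lambda_n$ (counted with multiplicity), i.e. $\lambda_j-\lambda_1^{i_1}\cdots\lambda_n^{i_n}\neq 0$ for all $1\le j\le n$ and all $(i_1,\dots,i_n)\in\mathbb N^n$ with $i_1+\dots+i_n\ge 2$. For $t\in\mathbb C^m$ put $$f_t(z)=Az+\sum_{|i|\le d}t^i f_i(z).$$ Let $F_t:\mathbb C^n\to\mathbb C^p$, $t\in\mathbb C^m$, be formal mappings (with $p$ components in $\mathbb C[[z_1,\dots,z_n]]$) whose coefficients are polynomials in $t$, such that, for some constants $C_0,C_1>0$, the coefficients of every monomial $z^\alpha$ with $|\alpha|=l$ have degree $<C_0+C_1l$ in $t$. Suppose that for every $t$ the equation $F_t(z)=0$ defines a formal submanifold through $0$ invariant under $f_t$, that is, $F_t(0)=0$, $D_0F_t$ has rank $p$,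 and every component of $F_t\circ f_t$ lies in the ideal of $\mathbb C[[z_1,\dots,z_n]]$ generated by the components of $F_t$. Then exactly one of the following holds: (1) for all $t\in\mathbb C^m$, $F_t$ converges in a neighbourhood of $0$ and defines a submanifold through $0$ invariant under $f_t$: $F_t$ is a holomorphic germ with $F_t(0)=0$ and $D_0F_t$ surjective, and for all $z$ near $0$, $F_t(f_t(z))=0$ if and only if $F_t(z)=0$; (2) $F_t$ diverges for all $t\in\mathbb C^m$ outside an exceptional set of $\Gamma$-capacity $0$, i.e. the set of those $t$ for which $F_t$ converges has $\Gamma$-capacity $0$. Here the $\Gamma$-capacity is defined as follows. The logarithmic capacity of a set $E\subset\mathbb C$ is $\operatorname{cap}(E)=\sup_\mu \exp\left(-\iint\log\frac1{|z-w|}\,d\mu(z)\,d\mu(w)\right)$, over the Borel probability measures $\mu$ carried by a compact subset of $E$. For $k\ge2$ the $\Gamma$-projection of $E\subset\mathbb C^k$ to $\mathbb C^{k-1}$ is the set of those $z\in\mathbb C^{k-1}$ for which $\{w\in\mathbb C:(z,w)\in E\}$ has positive logarithmic capacity; iterating, one obtains from $E\subset\mathbb C^m$ a set $\Gamma_m^1(E)\subset\mathbb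 C$ (with $\Gamma_1^1(E)=E$). The $\Gamma$-capacity of $E\subset\mathbb C^m$ is $\sup_U\operatorname{cap}\,\Gamma_m^1(U(E))$ over all unitary transformations $U$ of $\mathbb C^m$. -/

import Mathlib

open scoped Topology ENNReal

noncomputable section

/-! ### Formal and convergent maps

A formal map `ℂⁿ → ℂᵖ` is a `p`-tuple of formal power series in `n` variables; a germ of
holomorphic map at `0` is given by its Taylor series, that is, by a convergent formal map. -/

/-- Formal maps `ℂⁿ → ℂᵖ` at the origin. -/
abbrev FormalMap (n p : ℕ) : Type := Fin p → MvPowerSeries (Fin n) ℂ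

namespace FormalMap

variable {n p : ℕ}

/-- The term of multi-index `α` of the power series `φ`, at the point `z`. -/
def term (φ : MvPowerSeries (Fin n) ℂ) (z : Fin n → ℂ) (α : Fin n →₀ ℕ) : ℂ :=
  MvPowerSeries.coeff α φ * ∏ k, z k ^ α k

/-- `G` converges: each component converges at all points of a neighbourhood of `0`. -/
def Convergent (G : FormalMap n p) : Prop :=
  ∀ j, ∀ᶠ z in 𝓝 (0 : Fin n → ℂ), Summable (term (G j) z)

/-- The map defined near `0` by a convergent formal map. -/
def toFun (G : FormalMap n p) (z : Fin n → ℂ) : Fin p → ℂ :=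
  fun j => ∑' α, term (G j) z α

/-- `G` has valuation at least `v`: all monomials of degree `< v` have coefficient zero. -/
def ValuationGE (G : FormalMap n p) (v : ℕ) : Prop :=
  ∀ j, ∀ α : Fin n →₀ ℕ, α.degree < v → MvPowerSeries.coeff α (G j) = 0

/-- The matrix of the linear part `D₀ G`. -/
def linearPart (G : FormalMap n p) : Matrix (Fin p) (Fin n) ℂ :=
  Matrix.of fun j k => MvPowerSeries.coeff (Finsupp.single k 1) (G j)

/-- The equation `G = 0` defines a formal submanifold through `0` (of codimension `p`), and this
formal submanifold is invariant under the formal map `g` (with `g 0 = 0`): every component of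
`G ∘ g` lies in the ideal generated by the components of `G`. -/
structure IsFormalInvariantSubmanifold (g : FormalMap n n) (G : FormalMap n p) : Prop where
  zero : ∀ j, MvPowerSeries.constantCoeff (G j) = 0
  rank : (linearPart G).rank = p
  invariant : ∀ j, MvPowerSeries.subst g (G j) ∈ Ideal.span (Set.range G)

/-- The holomorphic map germ `G` is a submersion at `0` with `G 0 = 0`, so that `G = 0` defines a
germ `S` at `0` of complex submanifold of codimension `p`, and `S` is invariant under the germ of
diffeomorphism `g`: the germs at `0` of `S` and of `g⁻¹(S)` are equal. -/
structure IsInvariantSubmanifold (g : FormalMap n n) (G : FormalMap n p) : Prop where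
  analytic : AnalyticAt ℂ (toFun G) 0
  zero : toFun G 0 = 0
  submersion : Function.Surjective (fderiv ℂ (toFun G) 0)
  invariant : ∀ᶠ z in 𝓝 (0 : Fin n → ℂ), toFun G (toFun g z) = 0 ↔ toFun G z = 0

end FormalMap

/-- The eigenvalues `λ₁, …, λₙ` of `A`, counted with multiplicity, are non-resonant. -/
def NonResonant {n : ℕ} (A : Matrix (Fin n) (Fin n) ℂ) : Prop :=
  ∃ lam : Fin n → ℂ, A.charpoly = ∏ k, (Polynomial.X - Polynomial.C (lam k)) ∧
    ∀ (j : Fin n) (i : Fin n → ℕ), 2 ≤ ∑ k, i k → lam j - ∏ k, lam k ^ i k ≠ 0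

/-- `f_t(z) = A z + ∑_{|i| ≤ d} t^i f_i(z)`. -/
def polyFamily {n m : ℕ} (A : Matrix (Fin n) (Fin n) ℂ) (d : ℕ)
    (f : (Fin m → ℕ) → FormalMap n n) (t : Fin m → ℂ) : FormalMap n n :=
  fun j => (∑ k, A j k • MvPowerSeries.X k) +
    ∑ l ∈ Finset.range (d + 1), ∑ i ∈ Finset.piAntidiag Finset.univ l,
      (∏ k, t k ^ i k) • f i j

/-- Specialization at the parameter `t` of a formal map whose coefficients are polynomials
in the parameter. -/
def specialize {n m p : ℕ} (F : Fin p → MvPowerSeries (Fin n) (MvPolynomial (Fin m) ℂ))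
    (t : Fin m → ℂ) : FormalMap n p :=
  fun j => MvPowerSeries.map (MvPolynomial.eval t) (F j)

/-! ### Logarithmic capacity and `Γ`-capacity -/

/-- The logarithmic energy `∬ log (1 / |z - w|) dμ(z) dμ(w)`, as the difference of the integrals of
the positive and the negative part of the kernel (the kernel is `⊤` on the diagonal).
The second integral is finite when `μ` is a finite measure with compact support. -/
def logEnergy (μ : MeasureTheory.Measure ℂ) : EReal :=
  ((∫⁻ z, ∫⁻ w, (-(ENNReal.log (edist z w))).toENNReal ∂μ ∂μ : ℝ≥0∞) : EReal) -
    ((∫⁻ z, ∫⁻ w, (ENNReal.log (edist z w)).toENNReal ∂μ ∂μ : ℝ≥0∞) : EReal)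

/-- The logarithmic capacity of a set `E ⊆ ℂ`: the supremum of `exp (-I(μ))`, where `I` is the
logarithmic energy and `μ` runs over the Borel probability measures carried by a compact
subset of `E`. -/
def logCapacity (E : Set ℂ) : ℝ≥0∞ :=
  ⨆ (K : Set ℂ) (_ : IsCompact K) (_ : K ⊆ E) (μ : MeasureTheory.Measure ℂ)
    (_ : MeasureTheory.IsProbabilityMeasure μ) (_ : μ Kᶜ = 0), EReal.exp (-(logEnergy μ))

/-- The `Γ`-projection of `E ⊆ ℂ^(k+1)` to `ℂ^k`: the points `z` such that the slice
`{w | (z, w) ∈ E}` has positive logarithmic capacity. -/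
def gammaProj {k : ℕ} (E : Set (Fin (k + 1) → ℂ)) : Set (Fin k → ℂ) :=
  {z | 0 < logCapacity {w | (Fin.snoc z w : Fin (k + 1) → ℂ) ∈ E}}

/-- The iterated `Γ`-projection of `E ⊆ ℂ^m` to `ℂ`, for `m ≥ 1`. -/
def gammaProjLine : (m : ℕ) → Set (Fin m → ℂ) → Set ℂ
  | 0, _ => ∅
  | 1, E => {w | (fun _ => w) ∈ E}
  | k + 2, E => gammaProjLine (k + 1) (gammaProj E)

/-- The `Γ`-capacity of `E ⊆ ℂ^m`: the supremum, over the unitary transformations `U` of `ℂ^m`,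
of the logarithmic capacity of the iterated `Γ`-projection of `U(E)` to `ℂ`. -/
def gammaCapacity {m : ℕ} (E : Set (Fin m → ℂ)) : ℝ≥0∞ :=
  ⨆ U : Matrix.unitaryGroup (Fin m) ℂ,
    logCapacity (gammaProjLine m ((fun t => (U : Matrix (Fin m) (Fin m) ℂ).mulVec t) '' E))

end

/-!
The dichotomy does not involve the dynamics. The series `F_t` converges if and only if its
coefficients `P_α(t)`, which are polynomials in `t` of degree at most `C (|α| + 1)`, satisfy
`|P_α(t)| ≤ R ^ (|α| + 1)` for some `R` (`setOf_convergent_eq_geometricGrowthSet`). In one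
parameter, if this happens on a set of positive capacity, then by countable additivity one `R`
works on a compact set `K` which carries a measure of finite logarithmic energy, and a
Bernstein–Walsh inequality bounds `P_α(t)` geometrically at every `t`.

No equilibrium measure is needed for that inequality. Restricting the measure makes its potential
bounded on its support, hence, up to `log 2`, on the whole plane (`exists_bounded_potential`): the
point of `K` nearest to `ζ` is at most twice as far from any point of `K` as `ζ` is. Averaging then
shows that, for every finite family of points `ζ`, some `z ∈ K` satisfies
`∏ (1 + |ζ|) ≤ c ^ D ∏ |z - ζ|` (`exists_mem_multiset_prod_le`). Applied to the roots of a
polynomial, this compares its value at `t` with its maximum on `K`. Several parameters are treated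
by induction over the `Γ`-projections (`geometricGrowthSet_eq_univ`), and unitary changes of
parameters preserve degrees. The two alternatives exclude each other since `ℂ^m` has positive
`Γ`-capacity (`gammaCapacity_univ_ne_zero`).

The remaining point is that a convergent formally invariant submanifold is invariant
(`FormalMap.IsFormalInvariantSubmanifold.isInvariantSubmanifold`). The components of `F ∘ f` are
combinations of those of `F`, with a matrix of formal coefficients which is invertible because both
maps have rank `p`; so the formal ideals of `F` and `F ∘ f` coincide. If a holomorphic function is
in the formal ideal of a submersion `G`, then it is flat at `0` along `G = 0`: truncating the formal
coefficients gives this to every order. Parametrizing `G = 0` by the implicit function theorem and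
restricting to complex lines, the identity theorem in one variable shows that it vanishes on `G = 0`
(`eventually_eq_zero_of_mem_span`).
-/

/-! ### Logarithmic capacity and the Bernstein–Walsh inequality -/

section Capacity

open MeasureTheory

/-- The positive part of the logarithmic kernel `log (1 / |z - w|)`, equal to `⊤` on the
diagonal. -/
noncomputable def logKernel (z w : ℂ) : ℝ≥0∞ := (-(ENNReal.log (edist z w))).toENNReal

theorem logKernel_self (z : ℂ) : logKernel z z = ⊤ := by simp [logKernel]

theorem logKernel_of_ne {z w : ℂ} (h : z ≠ w) :
    logKernel z w = ENNReal.ofReal (-Real.log (dist z w)) := by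
  rw [logKernel, edist_dist, ENNReal.log_ofReal_of_pos (dist_pos.2 h)]
  rfl

theorem measurable_logKernel : Measurable (Function.uncurry logKernel) := by
  unfold logKernel Function.uncurry
  refine Measurable.ereal_toENNReal (Measurable.neg (Measurable.ennreal_log ?_))
  exact measurable_edist

theorem measurable_logKernel_right (z : ℂ) : Measurable (logKernel z) :=
  Measurable.of_uncurry_left measurable_logKernel

/-- A point `ζ'` at most twice as far from `w` as `ζ` has a kernel at most `log 2` smaller. This
replaces the maximum principle for logarithmic potentials. -/
theorem logKernel_le_log_two_add {w ζ ζ' : ℂ} (h : dist ζ' w ≤ 2 * dist ζ w) :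
    logKernel ζ w ≤ ENNReal.ofReal (Real.log 2) + logKernel ζ' w := by
  by_cases h' : ζ' = w
  · simp [h', logKernel_self]
  have h'' : ζ ≠ w := by
    rintro rfl
    simp only [dist_self, mul_zero] at h
    exact h' (dist_le_zero.1 h)
  rw [logKernel_of_ne h', logKernel_of_ne h'']
  refine le_trans (ENNReal.ofReal_le_ofReal ?_) ENNReal.ofReal_add_le
  have := Real.log_le_log (dist_pos.2 h') h
  rw [Real.log_mul two_ne_zero (dist_pos.2 h'').ne'] at this
  linarith

theorem exists_lintegral_logKernel_lt_top {E : Set ℂ} (hE : 0 < logCapacity E) :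
    ∃ (K : Set ℂ) (μ : Measure ℂ), IsCompact K ∧ K ⊆ E ∧ IsProbabilityMeasure μ ∧ μ Kᶜ = 0 ∧
      ∫⁻ z, ∫⁻ w, logKernel z w ∂μ ∂μ < ⊤ := by
  simp only [logCapacity, lt_iSup_iff] at hE
  obtain ⟨K, hK, hKE, μ, hμ, hμK, h⟩ := hE
  refine ⟨K, μ, hK, hKE, hμ, hμK, ?_⟩
  rw [EReal.zero_lt_exp_iff, bot_lt_iff_ne_bot, Ne, EReal.neg_eq_bot_iff] at h
  by_contra hlt
  rw [not_lt, top_le_iff] at hlt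
  apply h
  have hfin : ∫⁻ z, ∫⁻ w, (ENNReal.log (edist z w)).toENNReal ∂μ ∂μ ≠ ⊤ := by
    refine ne_top_of_le_ne_top (b := ∫⁻ z, ∫⁻ w, (ENNReal.log (Metric.ediam K)).toENNReal ∂μ ∂μ)
      ?_ ?_
    · simp only [lintegral_const, measure_univ, mul_one]
      rw [Ne, EReal.toENNReal_eq_top_iff, ENNReal.log_eq_top_iff]
      exact hK.isBounded.ediam_ne_top
    · have hae : ∀ᵐ z ∂μ, z ∈ K := hμK
      refine lintegral_mono_ae (hae.mono fun z hz => lintegral_mono_ae (hae.mono fun w hw => ?_))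
      exact EReal.toENNReal_le_toENNReal (ENNReal.log_monotone (Metric.edist_le_ediam_of_mem hz hw))
  unfold logEnergy
  change (((∫⁻ z, ∫⁻ w, logKernel z w ∂μ ∂μ : ℝ≥0∞) : EReal) - _) = ⊤
  rw [hlt]
  lift (∫⁻ z, ∫⁻ w, (ENNReal.log (edist z w)).toENNReal ∂μ ∂μ) to NNReal using hfin with a
  exact EReal.top_sub_coe a

/-- A set of positive capacity covered by countably many closed sets carries, in one of them, a
compactly supported measure whose logarithmic potential is bounded on the whole plane. -/
theorem exists_bounded_potential {E : Set ℂ} (hE : 0 < logCapacity E) {S : ℕ → Set ℂ}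
    (hS : ∀ n, IsClosed (S n)) (hES : E ⊆ ⋃ n, S n) :
    ∃ (n : ℕ) (K : Set ℂ) (μ : Measure ℂ) (B : ℝ≥0∞), IsCompact K ∧ K ⊆ S n ∧
      IsFiniteMeasure μ ∧ μ K ≠ 0 ∧ B ≠ ⊤ ∧ ∀ ζ, ∫⁻ w in K, logKernel ζ w ∂μ ≤ B := by
  obtain ⟨K, μ, hK, hKE, hμ, hμK, hfin⟩ := exists_lintegral_logKernel_lt_top hE
  have hμK1 : μ K ≠ 0 := by
    rw [(prob_compl_eq_zero_iff hK.measurableSet).1 hμK]; exact one_ne_zero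
  have hmeas : Measurable fun z => ∫⁻ w, logKernel z w ∂μ :=
    measurable_logKernel.lintegral_prod_right'
  -- The sets `K ∩ S n` on which the potential is at most `l` cover `K` up to a null set.
  let T : ℕ × ℕ → Set ℂ := fun a => (K ∩ S a.1) ∩ {z | ∫⁻ w, logKernel z w ∂μ ≤ a.2}
  have hcover : ∃ a, μ (T a) ≠ 0 := by
    by_contra! hall
    refine hμK1 (le_antisymm ?_ bot_le)
    have h1 : μ (⋃ a, T a) = 0 := measure_iUnion_null hall
    have h2 : μ {z | ¬ (∫⁻ w, logKernel z w ∂μ < ⊤)} = 0 := ae_lt_top hmeas hfin.ne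
    refine (measure_mono (t := (⋃ a, T a) ∪ {z | ¬ (∫⁻ w, logKernel z w ∂μ < ⊤)}) ?_).trans
      ((measure_union_le _ _).trans (by rw [h1, h2, add_zero]))
    intro z hz
    by_cases hz' : ∫⁻ w, logKernel z w ∂μ < ⊤
    · obtain ⟨n, hn⟩ := Set.mem_iUnion.1 (hES (hKE hz))
      obtain ⟨l, hl⟩ := ENNReal.exists_nat_gt hz'.ne
      exact Or.inl (Set.mem_iUnion.2 ⟨(n, l), ⟨hz, hn⟩, hl.le⟩)
    · exact Or.inr hz'
  obtain ⟨⟨n, l⟩, ha⟩ := hcover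
  have hTm : MeasurableSet (T (n, l)) :=
    (hK.measurableSet.inter (hS n).measurableSet).inter (measurableSet_le hmeas measurable_const)
  obtain ⟨K', hK'T, hK', hpos⟩ := hTm.exists_lt_isCompact (pos_iff_ne_zero.2 ha)
  have hne : K'.Nonempty := by
    rw [Set.nonempty_iff_ne_empty]; rintro rfl; simp at hpos
  refine ⟨n, K', μ, ENNReal.ofReal (Real.log 2) * μ K' + l, hK', fun z hz => (hK'T hz).1.2,
    inferInstance, hpos.ne', ?_, fun ζ => ?_⟩
  · exact ENNReal.add_ne_top.2 ⟨ENNReal.mul_ne_top ENNReal.ofReal_ne_top (measure_ne_top _ _),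
      ENNReal.natCast_ne_top l⟩
  obtain ⟨ζ', hζ', hd⟩ := hK'.exists_infDist_eq_dist hne ζ
  calc ∫⁻ w in K', logKernel ζ w ∂μ
      ≤ ∫⁻ w in K', (ENNReal.ofReal (Real.log 2) + logKernel ζ' w) ∂μ := by
        refine setLIntegral_mono' hK'.measurableSet fun w hw => logKernel_le_log_two_add ?_
        have h1 : dist ζ ζ' ≤ dist ζ w := hd ▸ Metric.infDist_le_dist_of_mem hw
        have h2 := dist_triangle ζ' ζ w
        rw [dist_comm ζ' ζ] at h2
        linarith
    _ = ENNReal.ofReal (Real.log 2) * μ K' + ∫⁻ w in K', logKernel ζ' w ∂μ := by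
        rw [lintegral_add_left measurable_const, setLIntegral_const]
    _ ≤ _ := by
        gcongr
        exact (setLIntegral_le_lintegral _ _).trans (hK'T hζ').2

/-- On a bounded set the distance to `ζ` is bounded below through the kernel, uniformly in `ζ`. -/
theorem one_add_norm_le_mul_exp_logKernel {ρ : ℝ} {z ζ : ℂ} (hz : ‖z‖ ≤ ρ)
    (h : logKernel ζ z ≠ ⊤) :
    1 + ‖ζ‖ ≤ (ρ + 2) * (‖z - ζ‖ * Real.exp (logKernel ζ z).toReal) := by
  have hne : ζ ≠ z := by rintro rfl; exact h (logKernel_self ζ)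
  have hρ : 0 ≤ ρ := (norm_nonneg z).trans hz
  have hpos : 0 < dist ζ z := dist_pos.2 hne
  have htri : ‖ζ‖ ≤ dist ζ z + ‖z‖ := by
    rw [dist_eq_norm]; simpa using norm_add_le (ζ - z) z
  rw [logKernel_of_ne hne, ← dist_eq_norm, dist_comm z ζ]
  rcases le_total 1 (dist ζ z) with h1 | h1
  · have : 1 ≤ Real.exp (ENNReal.ofReal (-Real.log (dist ζ z))).toReal :=
      Real.one_le_exp ENNReal.toReal_nonneg
    have : dist ζ z ≤ dist ζ z * Real.exp (ENNReal.ofReal (-Real.log (dist ζ z))).toReal :=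
      le_mul_of_one_le_right hpos.le this
    nlinarith
  · rw [ENNReal.toReal_ofReal (by linarith [Real.log_nonpos hpos.le h1]), Real.exp_neg,
      Real.exp_log hpos, mul_inv_cancel₀ hpos.ne']
    linarith

theorem multiset_prod_one_add_norm_le {ρ : ℝ} {z : ℂ} (hz : ‖z‖ ≤ ρ) (s : Multiset ℂ)
    (h : (s.map fun ζ => logKernel ζ z).sum ≠ ⊤) :
    (s.map fun ζ => 1 + ‖ζ‖).prod ≤ (ρ + 2) ^ s.card * ((s.map fun ζ => ‖z - ζ‖).prod *
      Real.exp ((s.map fun ζ => logKernel ζ z).sum).toReal) := by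
  have hρ : 0 ≤ ρ := (norm_nonneg z).trans hz
  induction s using Multiset.induction with
  | empty => simp
  | cons ζ s ih =>
    simp only [Multiset.map_cons, Multiset.sum_cons, Multiset.prod_cons, Multiset.card_cons] at h ⊢
    obtain ⟨h1, h2⟩ := ENNReal.add_ne_top.1 h
    rw [ENNReal.toReal_add h1 h2, Real.exp_add]
    have hs : 0 ≤ (s.map fun ζ => 1 + ‖ζ‖).prod :=
      Multiset.prod_nonneg fun a ha => by
        obtain ⟨b, -, rfl⟩ := Multiset.mem_map.1 ha; positivity
    refine (mul_le_mul (one_add_norm_le_mul_exp_logKernel hz h1) (ih h2) hs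
      (by positivity)).trans_eq ?_
    ring

/-- A compact set carrying a measure with bounded potential contains, for every finite family of
points, a point which is not close to the family, in geometric mean. -/
theorem exists_mem_multiset_prod_le {K : Set ℂ} {μ : Measure ℂ} [IsFiniteMeasure μ] {B : ℝ≥0∞}
    (hK : IsCompact K) (hμK : μ K ≠ 0) (hB : B ≠ ⊤)
    (h : ∀ ζ, ∫⁻ w in K, logKernel ζ w ∂μ ≤ B) :
    ∃ c : ℝ, 1 ≤ c ∧ ∀ s : Multiset ℂ, ∃ z ∈ K,
      (s.map fun ζ => 1 + ‖ζ‖).prod ≤ c ^ s.card * (s.map fun ζ => ‖z - ζ‖).prod := by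
  obtain ⟨ρ, hρ⟩ := hK.isBounded.exists_norm_le
  have hne : K.Nonempty := by
    rw [Set.nonempty_iff_ne_empty]; rintro rfl; simp at hμK
  have hρ0 : 0 ≤ ρ := let ⟨z, hz⟩ := hne; (norm_nonneg z).trans (hρ z hz)
  have hBK : (μ K)⁻¹ * B ≠ ⊤ := ENNReal.mul_ne_top (ENNReal.inv_ne_top.2 hμK) hB
  refine ⟨(ρ + 2) * Real.exp ((μ K)⁻¹ * B).toReal,
    one_le_mul_of_one_le_of_one_le (by linarith) (Real.one_le_exp ENNReal.toReal_nonneg),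
    fun s => ?_⟩
  have hm : Measurable fun w => (s.map fun ζ => logKernel ζ w).sum := by
    induction s using Multiset.induction with
    | empty => simp
    | cons ζ s ih =>
      simp only [Multiset.map_cons, Multiset.sum_cons]
      exact (measurable_logKernel_right ζ).add ih
  have hsum : ∫⁻ w in K, (s.map fun ζ => logKernel ζ w).sum ∂μ ≤ s.card * B := by
    clear hm
    induction s using Multiset.induction with
    | empty => simp
    | cons ζ s ih =>
      simp only [Multiset.map_cons, Multiset.sum_cons, Multiset.card_cons]
      rw [lintegral_add_left (measurable_logKernel_right ζ)]
      push_cast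
      rw [add_mul, one_mul, add_comm]
      exact add_le_add ih (h ζ)
  obtain ⟨z, hz, hle⟩ := exists_le_setLAverage (μ := μ) hμK (measure_ne_top _ _) hm.aemeasurable
  have hle' : (s.map fun ζ => logKernel ζ z).sum ≤ s.card * ((μ K)⁻¹ * B) := by
    refine hle.trans ?_
    rw [setLAverage_eq, ENNReal.div_eq_inv_mul]
    calc (μ K)⁻¹ * ∫⁻ w in K, (s.map fun ζ => logKernel ζ w).sum ∂μ
        ≤ (μ K)⁻¹ * (s.card * B) := by gcongr
      _ = _ := by ring
  have htop : (s.card : ℝ≥0∞) * ((μ K)⁻¹ * B) ≠ ⊤ :=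
    ENNReal.mul_ne_top (ENNReal.natCast_ne_top _) hBK
  refine ⟨z, hz, (multiset_prod_one_add_norm_le (hρ z hz) s
    (ne_top_of_le_ne_top htop hle')).trans ?_⟩
  have hexp : Real.exp ((s.map fun ζ => logKernel ζ z).sum).toReal ≤
      Real.exp ((μ K)⁻¹ * B).toReal ^ s.card := by
    rw [← Real.exp_nat_mul, Real.exp_le_exp]
    simpa using ENNReal.toReal_mono htop hle'
  have hs : 0 ≤ (s.map fun ζ => ‖z - ζ‖).prod :=
    Multiset.prod_nonneg fun a ha => by
      obtain ⟨b, -, rfl⟩ := Multiset.mem_map.1 ha; positivity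
  rw [mul_pow, mul_assoc, mul_comm (Multiset.prod _)]
  gcongr

theorem Polynomial.norm_eval_eq_leadingCoeff_mul_prod (Q : Polynomial ℂ) (t : ℂ) :
    ‖Q.eval t‖ = ‖Q.leadingCoeff‖ * (Q.roots.map fun ζ => ‖t - ζ‖).prod := by
  conv_lhs => rw [(IsAlgClosed.splits Q).eq_prod_roots]
  rw [Polynomial.eval_mul, Polynomial.eval_C, norm_mul, Polynomial.eval_multiset_prod,
    Multiset.map_map]
  congr 1
  have := (Multiset.prod_hom (Q.roots.map fun ζ => t - ζ) (normHom : ℂ →*₀ ℝ)).symm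
  rw [Multiset.map_map] at this
  simpa [Function.comp_def] using this

theorem multiset_prod_norm_sub_le (s : Multiset ℂ) (t : ℂ) :
    (s.map fun ζ => ‖t - ζ‖).prod ≤ (1 + ‖t‖) ^ s.card * (s.map fun ζ => 1 + ‖ζ‖).prod := by
  induction s using Multiset.induction with
  | empty => simp
  | cons ζ s ih =>
    simp only [Multiset.map_cons, Multiset.prod_cons, Multiset.card_cons]
    have hs : 0 ≤ (s.map fun ζ => ‖t - ζ‖).prod :=
      Multiset.prod_nonneg fun a ha => by
        obtain ⟨b, -, rfl⟩ := Multiset.mem_map.1 ha; positivity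
    have h1 : ‖t - ζ‖ ≤ (1 + ‖t‖) * (1 + ‖ζ‖) := by
      have := norm_sub_le t ζ
      nlinarith [norm_nonneg t, norm_nonneg ζ]
    refine (mul_le_mul h1 ih hs (by positivity)).trans_eq (by ring)

/-- **Bernstein–Walsh inequality**, without the sharp constant: a polynomial of degree at most `D`
bounded by `M` on a set as in `exists_mem_multiset_prod_le` grows at most like
`M * (c * (1 + |t|)) ^ D`. -/
theorem Polynomial.norm_eval_le_of_forall_mem {K : Set ℂ} {c : ℝ}
    (hK : ∀ s : Multiset ℂ, ∃ z ∈ K,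
      (s.map fun ζ => 1 + ‖ζ‖).prod ≤ c ^ s.card * (s.map fun ζ => ‖z - ζ‖).prod)
    (hc : 1 ≤ c) {Q : Polynomial ℂ} {D : ℕ} (hQ : Q.natDegree ≤ D) {M : ℝ}
    (hM : ∀ z ∈ K, ‖Q.eval z‖ ≤ M) (t : ℂ) : ‖Q.eval t‖ ≤ M * (c * (1 + ‖t‖)) ^ D := by
  obtain ⟨z, hz, hle⟩ := hK Q.roots
  have hcard : Q.roots.card ≤ D := (Polynomial.card_roots' Q).trans hQ
  have hprod := multiset_prod_norm_sub_le Q.roots t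
  have hM0 : 0 ≤ M := (norm_nonneg _).trans (hM z hz)
  calc ‖Q.eval t‖
      = ‖Q.leadingCoeff‖ * (Q.roots.map fun ζ => ‖t - ζ‖).prod :=
        Q.norm_eval_eq_leadingCoeff_mul_prod t
    _ ≤ ‖Q.leadingCoeff‖ * ((1 + ‖t‖) ^ Q.roots.card *
          (c ^ Q.roots.card * (Q.roots.map fun ζ => ‖z - ζ‖).prod)) := by
        gcongr
        exact hprod.trans (by gcongr)
    _ = ‖Q.eval z‖ * (c * (1 + ‖t‖)) ^ Q.roots.card := by
        rw [Q.norm_eval_eq_leadingCoeff_mul_prod z, mul_pow]; ring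
    _ ≤ M * (c * (1 + ‖t‖)) ^ D := by
        have h1 : 1 ≤ c * (1 + ‖t‖) := one_le_mul_of_one_le_of_one_le hc (by simp)
        gcongr
        · exact hM z hz

/-- One-variable dichotomy: if a family of polynomials of linearly bounded degree has geometric
growth at the points of a set of positive capacity, then it has geometric growth everywhere. -/
theorem Polynomial.exists_norm_eval_le_pow {I : Type*} (Q : I → Polynomial ℂ) (N : I → ℕ) (C : ℕ)
    (hQ : ∀ i, (Q i).natDegree ≤ C * (N i + 1))
    (h : 0 < logCapacity {w | ∃ R : ℝ, ∀ i, ‖(Q i).eval w‖ ≤ R ^ (N i + 1)}) :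
    ∃ R : ℝ, 0 ≤ R ∧ ∀ t i, ‖(Q i).eval t‖ ≤ (R * (1 + ‖t‖) ^ C) ^ (N i + 1) := by
  obtain ⟨n, K, μ, B, hK, hKS, hμ, hμK, hB, hpot⟩ := exists_bounded_potential h
    (S := fun n : ℕ => {w | ∀ i, ‖(Q i).eval w‖ ≤ (n : ℝ) ^ (N i + 1)})
    (fun n => by
      simp only [Set.ofPred_forall]
      exact isClosed_iInter fun i =>
        isClosed_le (Polynomial.continuous _).norm continuous_const)
    (fun w ⟨R, hR⟩ => by
      obtain ⟨n, hn⟩ := exists_nat_ge |R|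
      refine Set.mem_iUnion.2 ⟨n, fun i => (hR i).trans ?_⟩
      exact (le_abs_self _).trans (by rw [abs_pow]; gcongr))
  obtain ⟨c, hc, hfam⟩ := exists_mem_multiset_prod_le hK hμK hB hpot
  refine ⟨n * c ^ C, by positivity, fun t i => ?_⟩
  rw [mul_assoc, ← mul_pow, mul_pow, ← pow_mul]
  exact Polynomial.norm_eval_le_of_forall_mem hfam hc (hQ i) (fun z hz => hKS hz i) t

theorem logCapacity_mono {E E' : Set ℂ} (h : E ⊆ E') : logCapacity E ≤ logCapacity E' :=
  iSup_mono fun _ => iSup_mono fun _ => iSup_mono' fun hK => ⟨hK.trans h, le_rfl⟩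

theorem lintegral_logKernel_unitInterval_le (x : ℝ) (hx : x ∈ Set.Icc (0 : ℝ) 1) :
    ∫⁻ y in Set.Icc (0 : ℝ) 1, logKernel x y ≤
      ∫⁻ y in Set.Icc (-1 : ℝ) 1, ENNReal.ofReal (-Real.log y) := by
  have hae : ∀ᵐ y : ℝ ∂(volume.restrict (Set.Icc (0 : ℝ) 1)),
      logKernel x y = ENNReal.ofReal (-Real.log (x - y)) := by
    refine ae_restrict_of_ae ?_
    filter_upwards [Measure.ae_ne volume x] with y hy
    have : (x : ℂ) ≠ y := by exact_mod_cast hy.symm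
    rw [logKernel_of_ne this, dist_eq_norm, ← Complex.ofReal_sub, Complex.norm_real,
      Real.norm_eq_abs, Real.log_abs]
  rw [lintegral_congr_ae hae, ← lintegral_indicator measurableSet_Icc,
    ← lintegral_indicator measurableSet_Icc,
    ← lintegral_sub_left_eq_self (μ := volume)
      ((Set.Icc (-1 : ℝ) 1).indicator fun y => ENNReal.ofReal (-Real.log y)) x]
  refine lintegral_mono fun y => ?_
  by_cases hy : y ∈ Set.Icc (0 : ℝ) 1
  · rw [Set.indicator_of_mem hy, Set.indicator_of_mem]
    exact ⟨by linarith [hx.1, hy.2], by linarith [hx.2, hy.1]⟩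
  · rw [Set.indicator_of_notMem hy]
    exact bot_le

/-- The closed unit disc has positive capacity: Lebesgue measure on `[0, 1]` has finite energy. -/
theorem logCapacity_closedBall_pos : 0 < logCapacity (Metric.closedBall 0 1) := by
  let μ : Measure ℂ := (volume.restrict (Set.Icc (0 : ℝ) 1)).map ((↑) : ℝ → ℂ)
  have hm : Measurable ((↑) : ℝ → ℂ) := Complex.measurable_ofReal
  have hμ : IsProbabilityMeasure μ := by
    refine ⟨?_⟩
    rw [Measure.map_apply hm MeasurableSet.univ]
    simp
  have hμK : μ (Metric.closedBall 0 1)ᶜ = 0 := by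
    rw [Measure.map_apply hm Metric.isClosed_closedBall.measurableSet.compl,
      Measure.restrict_apply (hm Metric.isClosed_closedBall.measurableSet.compl)]
    convert measure_empty (μ := (volume : Measure ℝ))
    ext x
    simp only [Set.mem_inter_iff, Set.mem_preimage, Set.mem_compl_iff, mem_closedBall_zero_iff,
      Complex.norm_real, Real.norm_eq_abs, abs_le, Set.mem_Icc, Set.mem_empty_iff_false, iff_false]
    rintro ⟨h1, h2, h3⟩
    exact h1 ⟨by linarith, h3⟩
  have hlog : ∫⁻ y in Set.Icc (-1 : ℝ) 1, ENNReal.ofReal (-Real.log y) < ⊤ := by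
    have : IntegrableOn Real.log (Set.Icc (-1) 1) := by
      rw [integrableOn_Icc_iff_integrableOn_Ioc,
        ← intervalIntegrable_iff_integrableOn_Ioc_of_le (by norm_num)]
      exact intervalIntegral.intervalIntegrable_log'
    exact this.neg.lintegral_lt_top
  have hpos : ∫⁻ z, ∫⁻ w, logKernel z w ∂μ ∂μ < ⊤ := by
    have hm1 : Measurable fun z => ∫⁻ w, logKernel z w ∂μ :=
      measurable_logKernel.lintegral_prod_right'
    rw [lintegral_map hm1 hm]
    calc _ ≤ ∫⁻ x in Set.Icc (0 : ℝ) 1,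
          ∫⁻ y in Set.Icc (-1 : ℝ) 1, ENNReal.ofReal (-Real.log y) := by
          refine setLIntegral_mono' measurableSet_Icc fun x hx => ?_
          rw [lintegral_map (measurable_logKernel_right _) hm]
          exact lintegral_logKernel_unitInterval_le x hx
      _ < ⊤ := by
          rw [setLIntegral_const]
          exact ENNReal.mul_lt_top hlog (by simp)
  simp only [logCapacity, lt_iSup_iff]
  refine ⟨_, isCompact_closedBall 0 1, subset_rfl, μ, hμ, hμK, ?_⟩
  rw [EReal.zero_lt_exp_iff, bot_lt_iff_ne_bot, Ne, EReal.neg_eq_bot_iff]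
  intro h
  change (((∫⁻ z, ∫⁻ w, logKernel z w ∂μ ∂μ : ℝ≥0∞) : EReal) - _) = ⊤ at h
  refine absurd h (ne_of_lt (lt_of_le_of_lt
    (b := ((∫⁻ z, ∫⁻ w, logKernel z w ∂μ ∂μ : ℝ≥0∞) : EReal))
    ?_ (lt_top_iff_ne_top.2 (by rw [Ne, EReal.coe_ennreal_eq_top_iff]; exact hpos.ne))))
  refine (EReal.sub_le_sub le_rfl (EReal.coe_ennreal_nonneg _)).trans_eq (sub_zero _)

end Capacity

/-! ### Geometric growth of polynomial families and the `Γ`-capacity -/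

theorem MvPolynomial.totalDegree_aeval_le {σ τ : Type*} [Fintype σ] (P : MvPolynomial σ ℂ)
    (g : σ → MvPolynomial τ ℂ) (hg : ∀ k, (g k).totalDegree ≤ 1) :
    (aeval g P).totalDegree ≤ P.totalDegree := by
  rw [aeval_def, eval₂_eq']
  refine totalDegree_finsetSum_le fun a ha => ?_
  refine (totalDegree_mul _ _).trans ?_
  rw [algebraMap_eq, totalDegree_C, zero_add]
  refine (totalDegree_finsetProd _ _).trans ?_
  calc ∑ k, (g k ^ a k).totalDegree ≤ ∑ k, a k := Finset.sum_le_sum fun k _ =>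
        (totalDegree_pow _ _).trans (by simpa using Nat.mul_le_mul_left (a k) (hg k))
    _ = a.sum fun _ e => e := (Finsupp.sum_fintype a (fun _ e => e) fun _ => rfl).symm
    _ ≤ P.totalDegree := le_totalDegree ha

theorem MvPolynomial.eval_aeval_mvPolynomial {σ τ : Type*} [Fintype σ] (P : MvPolynomial σ ℂ)
    (g : σ → MvPolynomial τ ℂ) (t : τ → ℂ) :
    eval t (aeval g P) = eval (fun j => eval t (g j)) P := by
  rw [aeval_def, eval₂_eq', eval_eq' (fun j => eval t (g j))]
  simp

theorem MvPolynomial.eval_aeval_polynomial {σ : Type*} [Fintype σ] (P : MvPolynomial σ ℂ)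
    (g : σ → Polynomial ℂ) (w : ℂ) :
    (aeval g P).eval w = eval (fun j => (g j).eval w) P := by
  simp [aeval_def, eval₂_eq', eval_eq', Polynomial.eval_finsetSum, Polynomial.eval_prod]

/-- The set of parameters at which a family of polynomials has geometric growth with respect to
the weight `N`. -/
def geometricGrowthSet {m : ℕ} {I : Type*} (P : I → MvPolynomial (Fin m) ℂ) (N : I → ℕ) :
    Set (Fin m → ℂ) :=
  {t | ∃ R : ℝ, ∀ i, ‖MvPolynomial.eval t (P i)‖ ≤ R ^ (N i + 1)}

theorem gammaProj_mono {k : ℕ} {E E' : Set (Fin (k + 1) → ℂ)} (h : E ⊆ E') :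
    gammaProj E ⊆ gammaProj E' :=
  fun _ hz => lt_of_lt_of_le hz (logCapacity_mono fun _ hw => h hw)

theorem gammaProjLine_mono : ∀ {m : ℕ} {E E' : Set (Fin m → ℂ)}, E ⊆ E' →
    gammaProjLine m E ⊆ gammaProjLine m E'
  | 0, _, _, _ => subset_rfl
  | 1, _, _, h => fun _ hw => h hw
  | k + 2, _, _, h => gammaProjLine_mono (m := k + 1) (gammaProj_mono h)

/-- A family of polynomials of linearly bounded degree whose set of geometric growth has a
non-negligible iterated `Γ`-projection has geometric growth everywhere. In the induction step the
parameter is split as `(z, w)`, and the last coordinate `w`, restricted to the unit disc, becomes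
part of the index. -/
theorem geometricGrowthSet_eq_univ {k : ℕ} {I : Type} (P : I → MvPolynomial (Fin (k + 1)) ℂ)
    (N : I → ℕ) (C : ℕ) (hP : ∀ i, (P i).totalDegree ≤ C * (N i + 1))
    (h : 0 < logCapacity (gammaProjLine (k + 1) (geometricGrowthSet P N))) :
    geometricGrowthSet P N = Set.univ := by
  induction k generalizing I with
  | zero =>
    have hdeg : ∀ i, (MvPolynomial.aeval (fun _ => Polynomial.X) (P i) :
        Polynomial ℂ).natDegree ≤ C * (N i + 1) := fun i => by
      simpa using MvPolynomial.aeval_natDegree_le (P i) (hP i) (fun _ => Polynomial.X) (n := 1)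
        (fun _ => Polynomial.natDegree_X_le)
    have heval : ∀ i w, (MvPolynomial.aeval (fun _ => Polynomial.X) (P i) :
        Polynomial ℂ).eval w = MvPolynomial.eval (fun _ => w) (P i) := fun i w => by
      simp [MvPolynomial.eval_aeval_polynomial]
    obtain ⟨R, -, hR⟩ := Polynomial.exists_norm_eval_le_pow _ N C hdeg
      (by simp only [heval]; exact h)
    refine Set.eq_univ_of_forall fun t =>
      ⟨R * (1 + ‖t 0‖) ^ C, fun i => ?_⟩
    have := hR (t 0) i
    rw [heval] at this
    rwa [show (fun _ => t 0) = t from funext fun j => by rw [Fin.fin_one_eq_zero j]] at this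
  | succ k ih =>
    -- `S z` is the slice at `z`; `Q` adds the last coordinate to the index instead.
    let S : (Fin (k + 1) → ℂ) → I → Polynomial ℂ := fun z i =>
      MvPolynomial.aeval (Fin.snoc (fun j => Polynomial.C (z j)) Polynomial.X :
        Fin (k + 2) → Polynomial ℂ) (P i)
    have hSdeg : ∀ z i, (S z i).natDegree ≤ C * (N i + 1) := fun z i => by
      refine (MvPolynomial.aeval_natDegree_le (P i) (hP i) _ (n := 1) fun j => ?_).trans_eq
        (mul_one _)
      refine Fin.lastCases ?_ (fun j => ?_) j <;> simp
    have hS : ∀ z i w, (S z i).eval w = MvPolynomial.eval (Fin.snoc z w) (P i) := by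
      intro z i w
      rw [MvPolynomial.eval_aeval_polynomial]
      congr 2
      funext j
      refine Fin.lastCases ?_ (fun j => ?_) j <;> simp
    let Q : I × Metric.closedBall (0 : ℂ) 1 → MvPolynomial (Fin (k + 1)) ℂ := fun a =>
      MvPolynomial.aeval (Fin.snoc MvPolynomial.X (MvPolynomial.C (a.2 : ℂ)) :
        Fin (k + 2) → MvPolynomial (Fin (k + 1)) ℂ) (P a.1)
    have hQdeg : ∀ a, (Q a).totalDegree ≤ C * (N a.1 + 1) := fun a => by
      refine (MvPolynomial.totalDegree_aeval_le _ _ fun j => ?_).trans (hP a.1)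
      refine Fin.lastCases ?_ (fun j => ?_) j <;> simp
    have hQ : ∀ z a, MvPolynomial.eval z (Q a) = MvPolynomial.eval (Fin.snoc z a.2) (P a.1) := by
      intro z a
      rw [MvPolynomial.eval_aeval_mvPolynomial]
      congr 2
      funext j
      refine Fin.lastCases ?_ (fun j => ?_) j <;> simp
    have hsub : gammaProj (geometricGrowthSet P N) ⊆ geometricGrowthSet Q fun a => N a.1 := by
      intro z hz
      obtain ⟨R, hR0, hR⟩ := Polynomial.exists_norm_eval_le_pow (S z) N C (hSdeg z)
        (by simp only [hS]; exact hz)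
      refine ⟨R * (1 + 1) ^ C, fun a => ?_⟩
      rw [hQ, ← hS]
      refine (hR _ _).trans ?_
      have := mem_closedBall_zero_iff.1 a.2.2
      gcongr
    have huniv := ih Q (fun a => N a.1) hQdeg
      (h.trans_le (logCapacity_mono (gammaProjLine_mono hsub)))
    refine Set.eq_univ_of_forall fun t => ?_
    obtain ⟨R, hR⟩ := huniv.ge (Set.mem_univ (Fin.init t))
    obtain ⟨R', -, hR'⟩ := Polynomial.exists_norm_eval_le_pow (S (Fin.init t)) N C (hSdeg _)
      (logCapacity_closedBall_pos.trans_le (logCapacity_mono fun w hw =>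
        ⟨R, fun i => by rw [hS]; simpa only [hQ] using hR (i, ⟨w, hw⟩)⟩))
    refine ⟨R' * (1 + ‖t (Fin.last _)‖) ^ C, fun i => ?_⟩
    simpa only [hS, Fin.snoc_init_self] using hR' (t (Fin.last _)) i

theorem geometricGrowthSet_eq_univ_of_gammaCapacity {m : ℕ} {I : Type}
    (P : I → MvPolynomial (Fin m) ℂ) (N : I → ℕ) (C : ℕ)
    (hP : ∀ i, (P i).totalDegree ≤ C * (N i + 1))
    (h : gammaCapacity (geometricGrowthSet P N) ≠ 0) :
    geometricGrowthSet P N = Set.univ := by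
  rw [← pos_iff_ne_zero, gammaCapacity, lt_iSup_iff] at h
  obtain ⟨U, hU⟩ := h
  match m with
  | 0 =>
    obtain ⟨K, μ, -, hKE, hμ, hμK, -⟩ := exists_lintegral_logKernel_lt_top hU
    have hK : K = ∅ := Set.subset_empty_iff.1 hKE
    simp [hK] at hμK
  | k + 1 =>
  let Q : I → MvPolynomial (Fin (k + 1)) ℂ := fun i =>
    MvPolynomial.aeval (fun j => ∑ l, MvPolynomial.C ((star U : Matrix.unitaryGroup _ ℂ).1 j l) *
      MvPolynomial.X l) (P i)
  have hQ : ∀ i t, MvPolynomial.eval t (Q i) =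
      MvPolynomial.eval ((star U : Matrix.unitaryGroup _ ℂ).1.mulVec t) (P i) := fun i t => by
    rw [MvPolynomial.eval_aeval_mvPolynomial]
    congr 2
    funext j
    simp [Matrix.mulVec, dotProduct]
  have hUU : (star U : Matrix.unitaryGroup _ ℂ).1 * U.1 = 1 := Matrix.UnitaryGroup.star_mul_self U
  have hQdeg : ∀ i, (Q i).totalDegree ≤ C * (N i + 1) := fun i => by
    refine (MvPolynomial.totalDegree_aeval_le _ _ fun j => ?_).trans (hP i)
    refine MvPolynomial.totalDegree_finsetSum_le fun l _ =>
      (MvPolynomial.totalDegree_mul _ _).trans ?_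
    simp
  have himage : (fun t => U.1.mulVec t) '' geometricGrowthSet P N ⊆ geometricGrowthSet Q N := by
    rintro _ ⟨t, ⟨R, hR⟩, rfl⟩
    refine ⟨R, fun i => ?_⟩
    rw [hQ, Matrix.mulVec_mulVec, hUU, Matrix.one_mulVec]
    exact hR i
  have huniv := geometricGrowthSet_eq_univ Q N C hQdeg
    (hU.trans_le (logCapacity_mono (gammaProjLine_mono himage)))
  refine Set.eq_univ_of_forall fun t => ?_
  obtain ⟨R, hR⟩ := huniv.ge (Set.mem_univ (U.1.mulVec t))
  refine ⟨R, fun i => ?_⟩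
  have := hR i
  rwa [hQ, Matrix.mulVec_mulVec, hUU, Matrix.one_mulVec] at this

theorem gammaProjLine_univ : ∀ k : ℕ, gammaProjLine (k + 1) Set.univ = Set.univ
  | 0 => rfl
  | k + 1 => by
    have : gammaProj (Set.univ : Set (Fin (k + 1 + 1) → ℂ)) = Set.univ :=
      Set.eq_univ_of_forall fun z =>
        logCapacity_closedBall_pos.trans_le (logCapacity_mono fun _ _ => Set.mem_univ _)
    rw [gammaProjLine, this, gammaProjLine_univ k]

theorem gammaCapacity_univ_ne_zero {m : ℕ} (hm : 1 ≤ m) :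
    gammaCapacity (Set.univ : Set (Fin m → ℂ)) ≠ 0 := by
  obtain ⟨k, rfl⟩ := Nat.exists_eq_add_of_le' hm
  rw [← pos_iff_ne_zero, gammaCapacity, lt_iSup_iff]
  refine ⟨1, ?_⟩
  have : (fun t => ((1 : Matrix.unitaryGroup (Fin (k + 1)) ℂ) :
      Matrix (Fin (k + 1)) (Fin (k + 1)) ℂ).mulVec t) '' Set.univ = Set.univ := by simp
  rw [this, gammaProjLine_univ]
  exact logCapacity_closedBall_pos.trans_le (logCapacity_mono (Set.subset_univ _))

/-! ### Convergent power series in several variables -/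

theorem summable_pow_degree (n : ℕ) {ρ : ℝ} (h0 : 0 ≤ ρ) (h1 : ρ < 1) :
    Summable fun α : Fin n →₀ ℕ => ρ ^ α.degree := by
  classical
  refine summable_of_sum_le (c := ((1 - ρ)⁻¹) ^ n) (fun α => by positivity) fun s => ?_
  let M := s.sup fun α => α.degree
  calc ∑ α ∈ s, ρ ^ α.degree
      = ∑ a ∈ s.map ⟨fun α : Fin n →₀ ℕ => (α : Fin n → ℕ), DFunLike.coe_injective⟩,
          ∏ k, ρ ^ a k := by
        rw [Finset.sum_map]
        exact Finset.sum_congr rfl fun α _ => by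
          simp [Finsupp.degree_eq_sum, Finset.prod_pow_eq_pow_sum]
    _ ≤ ∑ a ∈ Fintype.piFinset fun _ : Fin n => Finset.range (M + 1), ∏ k, ρ ^ a k := by
        refine Finset.sum_le_sum_of_subset_of_nonneg (fun a ha => ?_)
          fun _ _ _ => Finset.prod_nonneg fun _ _ => by positivity
        obtain ⟨α, hα, rfl⟩ := Finset.mem_map.1 ha
        refine Fintype.mem_piFinset.2 fun k => Finset.mem_range_succ_iff.2 ?_
        exact (Finsupp.le_degree k α).trans (Finset.le_sup (f := fun α => α.degree) hα)
    _ = ∏ _k : Fin n, ∑ j ∈ Finset.range (M + 1), ρ ^ j :=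
        (Finset.prod_univ_sum _ _).symm
    _ ≤ ((1 - ρ)⁻¹) ^ n := by
        rw [Finset.prod_const, Finset.card_univ, Fintype.card_fin]
        gcongr
        rw [← tsum_geometric_of_lt_one h0 h1]
        exact (summable_geometric_of_lt_one h0 h1).sum_le_tsum _ fun _ _ => by positivity

namespace FormalMap

variable {n p : ℕ}

theorem norm_term_le (φ : MvPowerSeries (Fin n) ℂ) {z : Fin n → ℂ} {r : ℝ} (hz : ‖z‖ ≤ r)
    (α : Fin n →₀ ℕ) : ‖term φ z α‖ ≤ ‖MvPowerSeries.coeff α φ‖ * r ^ α.degree := by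
  rw [term, norm_mul, norm_prod, Finsupp.degree_eq_sum, ← Finset.prod_pow_eq_pow_sum]
  gcongr with k
  rw [norm_pow]
  gcongr
  exact (norm_le_pi_norm z k).trans hz

theorem exists_summable_of_eventually {φ : MvPowerSeries (Fin n) ℂ}
    (h : ∀ᶠ z in 𝓝 (0 : Fin n → ℂ), Summable (term φ z)) :
    ∃ r : ℝ, 0 < r ∧ Summable fun α => ‖MvPowerSeries.coeff α φ‖ * r ^ α.degree := by
  obtain ⟨ε, hε, hball⟩ := Metric.eventually_nhds_iff.1 h
  refine ⟨ε / 2, by positivity, ?_⟩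
  have hs := hball (y := fun _ => ((ε / 2 : ℝ) : ℂ)) (by
    refine lt_of_le_of_lt ?_ (half_lt_self hε)
    rw [dist_zero_right, pi_norm_le_iff_of_nonneg (by positivity)]
    intro i
    rw [Complex.norm_real, Real.norm_of_nonneg (by positivity)])
  refine hs.norm.congr fun α => ?_
  rw [term, norm_mul, Finset.prod_pow_eq_pow_sum, ← Finsupp.degree_eq_sum, norm_pow,
    Complex.norm_real, Real.norm_of_nonneg (by positivity)]

theorem eventually_summable_of_summable {φ : MvPowerSeries (Fin n) ℂ} {r : ℝ} (hr : 0 < r)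
    (h : Summable fun α => ‖MvPowerSeries.coeff α φ‖ * r ^ α.degree) :
    ∀ᶠ z in 𝓝 (0 : Fin n → ℂ), Summable (term φ z) := by
  filter_upwards [Metric.closedBall_mem_nhds 0 hr] with z hz
  exact Summable.of_norm_bounded h (norm_term_le φ (mem_closedBall_zero_iff.1 hz))

theorem eventually_summable_term_iff {φ : MvPowerSeries (Fin n) ℂ} :
    (∀ᶠ z in 𝓝 (0 : Fin n → ℂ), Summable (term φ z)) ↔
      ∃ R : ℝ, ∀ α, ‖MvPowerSeries.coeff α φ‖ ≤ R ^ (α.degree + 1) := by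
  constructor
  · intro h
    obtain ⟨r, hr, hs⟩ := exists_summable_of_eventually h
    let B := ∑' α, ‖MvPowerSeries.coeff α φ‖ * r ^ α.degree
    refine ⟨max B r⁻¹, fun α => ?_⟩
    have hB : ‖MvPowerSeries.coeff α φ‖ * r ^ α.degree ≤ B :=
      hs.le_tsum α fun _ _ => by positivity
    calc ‖MvPowerSeries.coeff α φ‖ = ‖MvPowerSeries.coeff α φ‖ * r ^ α.degree * r⁻¹ ^ α.degree := by
          rw [mul_assoc, ← mul_pow, mul_inv_cancel₀ hr.ne', one_pow, mul_one]
      _ ≤ max B r⁻¹ * (max B r⁻¹) ^ α.degree := by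
          gcongr
          · exact hB.trans (le_max_left _ _)
          · exact le_max_right _ _
      _ = _ := by ring
  · rintro ⟨R, hR⟩
    have hr : 0 < (2 * (|R| + 1))⁻¹ := by positivity
    refine eventually_summable_of_summable hr ?_
    refine Summable.of_nonneg_of_le (fun α => by positivity) (fun α => ?_)
      ((summable_pow_degree n (ρ := 1 / 2) (by norm_num) (by norm_num)).mul_left |R|)
    have h1 : ‖MvPowerSeries.coeff α φ‖ ≤ |R| ^ (α.degree + 1) :=
      (hR α).trans ((le_abs_self _).trans_eq (abs_pow _ _))
    have h2 : |R| * (2 * (|R| + 1))⁻¹ ≤ 1 / 2 := by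
      rw [← div_eq_mul_inv, div_le_div_iff₀ (by positivity) (by norm_num)]
      linarith [abs_nonneg R]
    calc ‖MvPowerSeries.coeff α φ‖ * (2 * (|R| + 1))⁻¹ ^ α.degree
        ≤ |R| ^ (α.degree + 1) * (2 * (|R| + 1))⁻¹ ^ α.degree := by gcongr
      _ = |R| * (|R| * (2 * (|R| + 1))⁻¹) ^ α.degree := by rw [mul_pow]; ring
      _ ≤ |R| * (1 / 2) ^ α.degree := by gcongr

/-- The monomial of multi-index `α` is the restriction to the diagonal of a product of
coordinates. -/
theorem exists_prod_eq_monomial {k : ℕ} (α : Fin n →₀ ℕ) (hα : α.degree = k) :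
    ∃ s : Fin k → Fin n, ∀ z : Fin n → ℂ, ∏ i, z (s i) = ∏ j, z j ^ α j := by
  have hlen : (Finsupp.toMultiset α).toList.length = k := by
    rw [Multiset.length_toList, Finsupp.card_toMultiset, ← hα]; rfl
  subst hlen
  refine ⟨(Finsupp.toMultiset α).toList.get, fun z => ?_⟩
  have h1 : ((Finsupp.toMultiset α).map z).prod = ∏ j, z j ^ α j := by
    rw [Finsupp.toMultiset_map, Finsupp.prod_toMultiset, Finsupp.prod_mapDomain_index (by simp)
      (fun _ _ _ => pow_add _ _ _), Finsupp.prod_fintype _ _ (by simp)]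
  rw [← h1]
  conv_rhs => rw [← Multiset.coe_toList (Finsupp.toMultiset α)]
  rw [Multiset.map_coe, Multiset.prod_coe, ← List.prod_ofFn]
  congr 1
  conv_rhs => rw [← List.ofFn_get (Finsupp.toMultiset α).toList, List.map_ofFn]
  rfl

theorem coe_finsuppAntidiag_univ (k : ℕ) :
    ((Finset.finsuppAntidiag (Finset.univ : Finset (Fin n)) k : Finset (Fin n →₀ ℕ)) :
      Set (Fin n →₀ ℕ)) = Finsupp.degree ⁻¹' {k} := by
  ext α
  simp [Finsupp.degree_eq_sum]

theorem exists_formalMultilinearSeries (φ : MvPowerSeries (Fin n) ℂ) :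
    ∃ q : FormalMultilinearSeries ℂ (Fin n → ℂ) ℂ, ∀ k,
      (∀ z, (q k fun _ => z) = ∑ α ∈ Finset.finsuppAntidiag Finset.univ k, term φ z α) ∧
      ‖q k‖ ≤ ∑ α ∈ Finset.finsuppAntidiag Finset.univ k, ‖MvPowerSeries.coeff α φ‖ := by
  have hmono : ∀ (k : ℕ) (α : Fin n →₀ ℕ), α.degree = k →
      ∃ q : ContinuousMultilinearMap ℂ (fun _ : Fin k => Fin n → ℂ) ℂ,
        (∀ z, (q fun _ => z) = ∏ j, z j ^ α j) ∧ ‖q‖ ≤ 1 := by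
    intro k α hα
    obtain ⟨s, hs⟩ := exists_prod_eq_monomial α hα
    refine ⟨(ContinuousMultilinearMap.mkPiAlgebra ℂ (Fin k) ℂ).compContinuousLinearMap
      fun i => ContinuousLinearMap.proj (s i), fun z => by simpa using hs z, ?_⟩
    refine ContinuousMultilinearMap.opNorm_le_bound zero_le_one fun m => ?_
    simp only [ContinuousMultilinearMap.compContinuousLinearMap_apply,
      ContinuousLinearMap.proj_apply, ContinuousMultilinearMap.mkPiAlgebra_apply, norm_prod,
      one_mul]
    exact Finset.prod_le_prod (fun _ _ => norm_nonneg _) fun i _ => norm_le_pi_norm _ _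
  choose! q hq using hmono
  have hdeg : ∀ {k : ℕ} {α : Fin n →₀ ℕ}, α ∈ Finset.finsuppAntidiag Finset.univ k →
      α.degree = k := fun {k α} h => by
    have : α ∈ (Finsupp.degree ⁻¹' {k} : Set (Fin n →₀ ℕ)) := by
      rw [← coe_finsuppAntidiag_univ]; exact h
    exact this
  refine ⟨fun k => ∑ α ∈ Finset.finsuppAntidiag Finset.univ k,
    MvPowerSeries.coeff α φ • q k α, fun k => ⟨fun z => ?_, ?_⟩⟩
  · rw [sum_apply]
    refine Finset.sum_congr rfl fun α hα => ?_
    rw [smul_apply, (hq k α (hdeg hα)).1, smul_eq_mul, term]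
  · refine (norm_sum_le _ _).trans (Finset.sum_le_sum fun α hα => ?_)
    rw [norm_smul]
    exact mul_le_of_le_one_right (norm_nonneg _) (hq k α (hdeg hα)).2

/-- The sum of a convergent power series is analytic, and its Taylor polynomials are the
truncations of the series. -/
theorem exists_hasFPowerSeriesAt_tsum_term {φ : MvPowerSeries (Fin n) ℂ}
    (h : ∀ᶠ z in 𝓝 (0 : Fin n → ℂ), Summable (term φ z)) :
    ∃ q : FormalMultilinearSeries ℂ (Fin n → ℂ) ℂ,
      HasFPowerSeriesAt (fun z => ∑' α, term φ z α) q 0 ∧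
      ∀ k z, (q k fun _ => z) = ∑ α ∈ Finset.finsuppAntidiag Finset.univ k, term φ z α := by
  obtain ⟨q, hq⟩ := exists_formalMultilinearSeries φ
  refine ⟨q, ?_, fun k => (hq k).1⟩
  obtain ⟨r, hr, hs⟩ := exists_summable_of_eventually h
  refine ⟨ENNReal.ofReal r, ?_, by simpa using hr, fun {y} hy => ?_⟩
  · refine q.le_radius_of_bound (∑' α, ‖MvPowerSeries.coeff α φ‖ * r ^ α.degree) fun k => ?_
    rw [Real.coe_toNNReal r hr.le]
    calc ‖q k‖ * r ^ k
        ≤ (∑ α ∈ Finset.finsuppAntidiag Finset.univ k, ‖MvPowerSeries.coeff α φ‖) * r ^ k := by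
          gcongr; exact (hq k).2
      _ = ∑ α ∈ Finset.finsuppAntidiag Finset.univ k,
            ‖MvPowerSeries.coeff α φ‖ * r ^ α.degree := by
          rw [Finset.sum_mul]
          refine Finset.sum_congr rfl fun α hα => ?_
          rw [Finsupp.degree_eq_sum, (Finset.mem_finsuppAntidiag.1 hα).1]
      _ ≤ _ := hs.sum_le_tsum _ fun _ _ => by positivity
  · have hy' : ‖y‖ ≤ r := by
      rw [Metric.mem_eball, edist_zero_right, ← ofReal_norm, ENNReal.ofReal_lt_ofReal_iff hr] at hy
      exact hy.le
    have hsum : Summable (term φ y) := Summable.of_norm_bounded hs (norm_term_le φ hy')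
    rw [zero_add]
    convert hsum.hasSum.tsum_fiberwise Finsupp.degree using 2 with k
    rw [(hq k).1, ← coe_finsuppAntidiag_univ]
    exact (Finset.tsum_subtype' _ _).symm

end FormalMap

/-! ### Asymptotic expansions at the origin -/

section Expansion

open Asymptotics

variable {n : ℕ}

/-- The function `h` agrees near `0` with the formal power series `φ` up to terms of degree at
least `N`. -/
def ExpandsTo (N : ℕ) (h : (Fin n → ℂ) → ℂ) (φ : MvPowerSeries (Fin n) ℂ) : Prop :=
  (fun z => h z - MvPolynomial.eval z (φ.truncTotal N)) =O[𝓝 0] fun z => ‖z‖ ^ N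

theorem MvPolynomial.isBigO_eval_of_coeff_eq_zero {N : ℕ} {P : MvPolynomial (Fin n) ℂ}
    (hP : ∀ α : Fin n →₀ ℕ, α.degree < N → P.coeff α = 0) :
    (fun z => eval z P) =O[𝓝 0] fun z => ‖z‖ ^ N := by
  simp only [eval_eq']
  refine IsBigO.fun_sum fun α hα => ?_
  have hdeg : N ≤ α.degree := not_lt.1 fun h => mem_support_iff.1 hα (hP α h)
  refine IsBigO.of_bound ‖P.coeff α‖ ?_
  filter_upwards [Metric.closedBall_mem_nhds (0 : Fin n → ℂ) one_pos] with z hz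
  rw [mem_closedBall_zero_iff] at hz
  rw [norm_mul, norm_pow, norm_norm, norm_prod]
  gcongr
  calc ∏ k, ‖z k ^ α k‖ ≤ ∏ k, ‖z‖ ^ α k := by
        gcongr with k
        rw [norm_pow]
        gcongr
        exact norm_le_pi_norm z k
    _ = ‖z‖ ^ α.degree := by rw [Finset.prod_pow_eq_pow_sum, Finsupp.degree_eq_sum]
    _ ≤ ‖z‖ ^ N := pow_le_pow_of_le_one (norm_nonneg z) hz hdeg

namespace ExpandsTo

variable {N : ℕ} {h h₁ h₂ : (Fin n → ℂ) → ℂ} {φ φ₁ φ₂ : MvPowerSeries (Fin n) ℂ}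

/-- Any polynomial congruent to the series may replace its truncation. -/
theorem iff_of_coeff_eq {P : MvPolynomial (Fin n) ℂ}
    (hP : ∀ α : Fin n →₀ ℕ, α.degree < N → P.coeff α = MvPowerSeries.coeff α φ) :
    ExpandsTo N h φ ↔ (fun z => h z - MvPolynomial.eval z P) =O[𝓝 0] fun z => ‖z‖ ^ N := by
  have key : (fun z => MvPolynomial.eval z (φ.truncTotal N - P)) =O[𝓝 0] fun z => ‖z‖ ^ N :=
    MvPolynomial.isBigO_eval_of_coeff_eq_zero fun α hα => by
      rw [MvPolynomial.coeff_sub, MvPowerSeries.coeff_truncTotal _ hα, hP α hα, sub_self]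
  simp only [map_sub] at key
  constructor
  · intro H
    exact (H.add key).congr_left fun z => by ring
  · intro H
    exact (H.sub key).congr_left fun z => by ring

theorem congr (H : ExpandsTo N h φ₁)
    (hφ : ∀ α : Fin n →₀ ℕ, α.degree < N →
      MvPowerSeries.coeff α φ₁ = MvPowerSeries.coeff α φ₂) : ExpandsTo N h φ₂ :=
  (iff_of_coeff_eq fun α hα => by rw [MvPowerSeries.coeff_truncTotal _ hα, hφ α hα]).2 H

theorem eval (N : ℕ) (P : MvPolynomial (Fin n) ℂ) :
    ExpandsTo N (fun z => MvPolynomial.eval z P) P :=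
  (iff_of_coeff_eq fun α _ => (MvPolynomial.coeff_coe P α).symm).2 <| by
    simpa using isBigO_zero _ _

theorem add (H₁ : ExpandsTo N h₁ φ₁) (H₂ : ExpandsTo N h₂ φ₂) :
    ExpandsTo N (fun z => h₁ z + h₂ z) (φ₁ + φ₂) :=
  (IsBigO.add H₁ H₂).congr_left fun z => by simp only [map_add]; ring

theorem isBigO_sub (H₁ : ExpandsTo N h₁ φ) (H₂ : ExpandsTo N h₂ φ) :
    (fun z => h₁ z - h₂ z) =O[𝓝 0] fun z => ‖z‖ ^ N :=
  (IsBigO.sub H₁ H₂).congr_left fun z => by ring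

theorem isBigO_one (H : ExpandsTo N h φ) : h =O[𝓝 0] fun _ => (1 : ℝ) := by
  have h1 : (fun z : Fin n → ℂ => ‖z‖ ^ N) =O[𝓝 0] fun _ => (1 : ℝ) :=
    ((continuous_norm.pow N).tendsto (0 : Fin n → ℂ)).isBigO_one ℝ
  have h2 : (fun z : Fin n → ℂ => MvPolynomial.eval z (φ.truncTotal N)) =O[𝓝 0]
      fun _ => (1 : ℝ) :=
    ((MvPolynomial.continuous_eval _).tendsto (0 : Fin n → ℂ)).isBigO_one ℝ
  exact ((IsBigO.trans H h1).add h2).congr_left fun z => by ring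

theorem mul (H₁ : ExpandsTo N h₁ φ₁) (H₂ : ExpandsTo N h₂ φ₂) :
    ExpandsTo N (fun z => h₁ z * h₂ z) (φ₁ * φ₂) := by
  refine (iff_of_coeff_eq (P := φ₁.truncTotal N * φ₂.truncTotal N) fun α hα =>
    MvPowerSeries.coeff_truncTotal_mul_truncTotal_eq_coeff_mul _ _ hα).2 ?_
  have h1 : (fun z : Fin n → ℂ => MvPolynomial.eval z (φ₁.truncTotal N)) =O[𝓝 0]
      fun _ => (1 : ℝ) :=
    ((MvPolynomial.continuous_eval _).tendsto (0 : Fin n → ℂ)).isBigO_one ℝ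
  have h2 := IsBigO.mul H₁ H₂.isBigO_one
  have h3 := IsBigO.mul h1 H₂
  simp only [mul_one, one_mul] at h2 h3
  exact (h2.add h3).congr_left fun z => by simp only [map_mul]; ring

theorem sum {ι : Type*} {s : Finset ι} {h : ι → (Fin n → ℂ) → ℂ}
    {φ : ι → MvPowerSeries (Fin n) ℂ} (H : ∀ i ∈ s, ExpandsTo N (h i) (φ i)) :
    ExpandsTo N (fun z => ∑ i ∈ s, h i z) (∑ i ∈ s, φ i) := by
  refine (IsBigO.fun_sum H).congr_left fun z => ?_
  simp only [map_sum, Finset.sum_sub_distrib]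

theorem aeval {p : ℕ} {f : Fin p → (Fin n → ℂ) → ℂ} {ψ : Fin p → MvPowerSeries (Fin n) ℂ}
    (H : ∀ k, ExpandsTo N (f k) (ψ k)) (P : MvPolynomial (Fin p) ℂ) :
    ExpandsTo N (fun z => MvPolynomial.eval (fun k => f k z) P) (MvPolynomial.aeval ψ P) := by
  induction P using MvPolynomial.induction_on with
  | C a =>
    have := ExpandsTo.eval N (MvPolynomial.C a : MvPolynomial (Fin n) ℂ)
    simpa [MvPolynomial.coe_C, MvPowerSeries.algebraMap_apply] using this
  | add P Q hP hQ => simpa only [map_add] using hP.add hQ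
  | mul_X P k hP =>
    simpa only [map_mul, MvPolynomial.eval_X, MvPolynomial.aeval_X] using hP.mul (H k)

theorem apply_zero (H : ExpandsTo 1 h φ) : h 0 = MvPowerSeries.constantCoeff φ := by
  have H' := (iff_of_coeff_eq (P := MvPolynomial.C (MvPowerSeries.constantCoeff φ))
    fun α hα => by
      rw [Nat.lt_one_iff, Finsupp.degree_eq_zero_iff] at hα
      simp [hα]).1 H
  have := IsBigO.eq_zero_of_norm_pow (x₀ := (0 : Fin n → ℂ)) (n := 1)
    (by simpa only [sub_zero] using H') one_ne_zero
  simpa [sub_eq_zero] using this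

theorem hasFDerivAt (H : ExpandsTo 2 h φ) :
    HasFDerivAt h (∑ k, MvPowerSeries.coeff (Finsupp.single k 1) φ •
      (ContinuousLinearMap.proj k : (Fin n → ℂ) →L[ℂ] ℂ)) 0 := by
  have hP : ∀ α : Fin n →₀ ℕ, α.degree < 2 →
      (MvPolynomial.C (MvPowerSeries.constantCoeff φ) + ∑ k,
        MvPolynomial.C (MvPowerSeries.coeff (Finsupp.single k 1) φ) * MvPolynomial.X k :
          MvPolynomial (Fin n) ℂ).coeff α = MvPowerSeries.coeff α φ := by
    classical
    intro α hα
    simp only [MvPolynomial.coeff_add, MvPolynomial.coeff_C, MvPolynomial.coeff_sum,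
      MvPolynomial.coeff_C_mul, MvPolynomial.coeff_X]
    have hα' : α.degree = 0 ∨ α.degree = 1 := by omega
    rcases hα' with h0 | h1
    · rw [Finsupp.degree_eq_zero_iff] at h0
      simp [h0]
    · obtain ⟨k, rfl⟩ := (Finsupp.sum_eq_one_iff α).1 h1
      simp [Finsupp.single_left_inj, eq_comm (a := (0 : Fin n →₀ ℕ))]
  have H' := (iff_of_coeff_eq hP).1 H
  have h0 := IsBigO.hasFDerivAt (𝕜 := ℂ) (x₀ := (0 : Fin n → ℂ)) (n := 2)
    (by simpa only [sub_zero] using H') one_lt_two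
  have h1 : HasFDerivAt (fun z : Fin n → ℂ => MvPowerSeries.constantCoeff φ +
      ∑ k, MvPowerSeries.coeff (Finsupp.single k 1) φ * z k)
      (∑ k, MvPowerSeries.coeff (Finsupp.single k 1) φ •
        (ContinuousLinearMap.proj k : (Fin n → ℂ) →L[ℂ] ℂ)) 0 := by
    have := ((∑ k, MvPowerSeries.coeff (Finsupp.single k 1) φ •
        (ContinuousLinearMap.proj k : (Fin n → ℂ) →L[ℂ] ℂ)).hasFDerivAt (x := 0)).const_add
        (MvPowerSeries.constantCoeff φ)
    simpa using this
  have h2 := h0.add h1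
  rw [zero_add] at h2
  refine h2.congr_of_eventuallyEq (Filter.Eventually.of_forall fun z => ?_)
  simp

theorem isBigO_norm (H : ExpandsTo 1 h φ) (hφ : MvPowerSeries.constantCoeff φ = 0) :
    h =O[𝓝 0] fun z => ‖z‖ := by
  have H' := (iff_of_coeff_eq (P := 0) fun α hα => by
      rw [Nat.lt_one_iff, Finsupp.degree_eq_zero_iff] at hα
      simp [hα, hφ]).1 H
  simpa using H'

/-- Formal substitution computes the expansion of a composition. -/
theorem comp {p : ℕ} {f : Fin p → (Fin n → ℂ) → ℂ} {ψ : Fin p → MvPowerSeries (Fin n) ℂ}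
    {h : (Fin p → ℂ) → ℂ} {φ : MvPowerSeries (Fin p) ℂ}
    (H : ExpandsTo N h φ) (Hf : ∀ k, ExpandsTo N (f k) (ψ k))
    (Hf1 : ∀ k, ExpandsTo 1 (f k) (ψ k)) (hψ : ∀ k, MvPowerSeries.constantCoeff (ψ k) = 0) :
    ExpandsTo N (fun z => h fun k => f k z) (MvPowerSeries.subst ψ φ) := by
  have hsub : MvPowerSeries.HasSubst ψ := MvPowerSeries.hasSubst_of_constantCoeff_zero hψ
  have hO : (fun z k => f k z) =O[𝓝 0] fun z => ‖z‖ :=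
    isBigO_pi.2 fun k => (Hf1 k).isBigO_norm (hψ k)
  have htend : Filter.Tendsto (fun z k => f k z) (𝓝 0) (𝓝 0) :=
    hO.trans_tendsto (by simpa using (continuous_norm.tendsto (0 : Fin n → ℂ)))
  have h1 := (IsBigO.comp_tendsto H htend).trans (hO.norm_left.pow N)
  -- substituting into the remainder of `φ`, of order at least `N`, gives order at least `N`
  have h2 : ExpandsTo N (fun z => MvPolynomial.eval (fun k => f k z) (φ.truncTotal N))
      (MvPowerSeries.subst ψ φ) := by
    refine (ExpandsTo.aeval Hf (φ.truncTotal N)).congr fun α hα => ?_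
    rw [← MvPowerSeries.subst_coe, ← sub_eq_zero, ← map_sub, ← neg_sub, map_neg, neg_eq_zero,
      ← MvPowerSeries.coe_substAlgHom hsub, ← map_sub, MvPowerSeries.coe_substAlgHom]
    refine MvPowerSeries.coeff_of_lt_order (lt_of_lt_of_le (Nat.cast_lt.2 hα) ?_)
    refine le_trans ?_ (MvPowerSeries.le_order_subst hsub _)
    rw [← one_mul (N : ℕ∞)]
    refine mul_le_mul' (le_iInf fun k => ?_) (MvPowerSeries.nat_le_order fun β hβ => ?_)
    · exact (MvPowerSeries.one_le_order_iff_constCoeff_eq_zero).2 (hψ k)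
    · rw [map_sub, MvPolynomial.coeff_coe, MvPowerSeries.coeff_truncTotal _ hβ, sub_self]
  exact (h1.add h2).congr_left fun z => by simp

end ExpandsTo

open FormalMap in
/-- The sum of a convergent power series expands to the series, to every order. -/
theorem expandsTo_tsum_term {φ : MvPowerSeries (Fin n) ℂ}
    (h : ∀ᶠ z in 𝓝 (0 : Fin n → ℂ), Summable (term φ z)) (N : ℕ) :
    ExpandsTo N (fun z => ∑' α, term φ z α) φ := by
  obtain ⟨q, hq, hqk⟩ := exists_hasFPowerSeriesAt_tsum_term h
  let P : MvPolynomial (Fin n) ℂ := ∑ k ∈ Finset.range N,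
    ∑ α ∈ Finset.finsuppAntidiag Finset.univ k, MvPolynomial.monomial α (MvPowerSeries.coeff α φ)
  refine (ExpandsTo.iff_of_coeff_eq (P := P) fun α hα => ?_).2 ?_
  · simp only [P, MvPolynomial.coeff_sum, MvPolynomial.coeff_monomial, Finset.sum_ite_eq',
      Finset.mem_finsuppAntidiag, Finset.subset_univ, and_true, ← Finsupp.degree_eq_sum,
      Finset.sum_ite_eq, Finset.mem_range, hα, if_true]
  · have := hq.isBigO_sub_partialSum_pow N
    simp only [zero_add] at this
    refine this.congr_left fun z => ?_
    simp only [P, map_sum, FormalMultilinearSeries.partialSum, hqk, MvPolynomial.eval_monomial,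
      Finsupp.prod_pow, term]

end Expansion

/-! ### Flat functions on complex submanifolds -/

section Flat

open Asymptotics

/-- A holomorphic function on a disc which is flat at the centre vanishes. -/
theorem eq_zero_of_forall_isBigO_pow {g : ℂ → ℂ} (hg : DifferentiableOn ℂ g (Metric.ball 0 2))
    (hflat : ∀ N : ℕ, g =O[𝓝 0] fun s => ‖s‖ ^ N) : g 1 = 0 := by
  have han := hg.analyticOnNhd Metric.isOpen_ball
  have h0 : (0 : ℂ) ∈ Metric.ball (0 : ℂ) 2 := by simp
  have hlocal : g =ᶠ[𝓝 0] 0 := by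
    refine analyticOrderAt_eq_top.1 ?_
    by_contra htop
    obtain ⟨g₁, hg₁, hne, heq⟩ := (han 0 h0).analyticOrderAt_ne_top.1 htop
    set k := analyticOrderNatAt g 0
    apply hne
    obtain ⟨c, hc⟩ := (hflat (k + 1)).bound
    have hle : ∀ᶠ s in 𝓝[≠] (0 : ℂ), ‖g₁ s‖ ≤ c * ‖s‖ := by
      filter_upwards [hc.filter_mono nhdsWithin_le_nhds, heq.filter_mono nhdsWithin_le_nhds,
        self_mem_nhdsWithin] with s hs hs' hs0
      rw [hs', sub_zero, norm_smul, norm_pow, norm_pow, norm_norm, pow_succ] at hs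
      have hpos : 0 < ‖s‖ ^ k := pow_pos (norm_pos_iff.2 hs0) k
      refine le_of_mul_le_mul_left ?_ hpos
      linarith
    have hlim : Filter.Tendsto (fun s : ℂ => ‖g₁ s‖) (𝓝[≠] 0) (𝓝 ‖g₁ 0‖) :=
      (hg₁.continuousAt.norm.tendsto).mono_left nhdsWithin_le_nhds
    have hlim' : Filter.Tendsto (fun s : ℂ => c * ‖s‖) (𝓝[≠] 0) (𝓝 0) := by
      have : Filter.Tendsto (fun s : ℂ => c * ‖s‖) (𝓝 0) (𝓝 (c * ‖(0 : ℂ)‖)) :=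
        (continuous_const.mul continuous_norm).tendsto 0
      simpa using this.mono_left nhdsWithin_le_nhds
    exact norm_le_zero_iff.1 (le_of_tendsto_of_tendsto hlim hlim' hle)
  exact han.eqOn_zero_of_preconnected_of_eventuallyEq_zero
    (convex_ball (0 : ℂ) 2).isPreconnected h0 hlocal (by simp)

/-- Let `G = 0` be a germ of submanifold. If `h` lies, to every order at the origin, in the ideal
generated by the components of `G`, then `h` vanishes on `G = 0`. A point of the submanifold is
joined to the origin by a holomorphic disc contained in it, on which `h` is flat. -/
theorem eventually_eq_zero_of_flat {n p : ℕ} {G : (Fin n → ℂ) → Fin p → ℂ}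
    {h : (Fin n → ℂ) → ℂ} (hG : AnalyticAt ℂ G 0) (hG0 : G 0 = 0)
    (hsurj : Function.Surjective (fderiv ℂ G 0)) (hh : AnalyticAt ℂ h 0)
    (hflat : ∀ N : ℕ, ∃ a : Fin p → (Fin n → ℂ) → ℂ,
      (fun z => h z - ∑ l, a l z * G z l) =O[𝓝 0] fun z => ‖z‖ ^ N) :
    ∀ᶠ z in 𝓝 0, G z = 0 → h z = 0 := by
  obtain ⟨π, hπ⟩ := (fderiv ℂ G 0).ker_closedComplemented_of_finiteDimensional_range
  let D : ImplicitFunctionData ℂ (Fin n → ℂ) (Fin p → ℂ) (fderiv ℂ G 0).ker :=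
    { leftFun := G
      leftDeriv := fderiv ℂ G 0
      rightFun := π
      rightDeriv := π
      pt := 0
      hasStrictFDerivAt_leftFun := hG.hasStrictFDerivAt
      hasStrictFDerivAt_rightFun := π.hasStrictFDerivAt
      range_leftDeriv := LinearMap.range_eq_top.2 hsurj
      range_rightDeriv := LinearMap.range_eq_of_proj hπ
      isCompl_ker := LinearMap.isCompl_of_proj hπ }
  let Φ := D.toOpenPartialHomeomorph
  have hΦ : ∀ z, Φ z = (G z, π z) := fun z => rfl
  have hsrc : (0 : Fin n → ℂ) ∈ Φ.source := D.pt_mem_toOpenPartialHomeomorph_source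
  have hΦ0 : Φ 0 = 0 := by rw [hΦ, hG0, map_zero]; rfl
  have hsymm0 : Φ.symm 0 = 0 := by rw [← hΦ0, Φ.left_inv hsrc]
  have hΦan : AnalyticAt ℂ Φ 0 := hG.prod (π.analyticAt 0)
  have hψ : AnalyticAt ℂ Φ.symm 0 := by
    have := Φ.analyticAt_symm' hsrc hΦan D.hasStrictFDerivAt.hasFDerivAt.fderiv
    rwa [hΦ0] at this
  have hψc : Filter.Tendsto Φ.symm (𝓝 0) (𝓝 0) := by
    simpa only [hsymm0] using hψ.continuousAt.tendsto
  have htgt : Φ.target ∈ 𝓝 (0 : (Fin p → ℂ) × (fderiv ℂ G 0).ker) :=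
    Φ.open_target.mem_nhds (hΦ0 ▸ Φ.map_source hsrc)
  obtain ⟨ρ, hρ, hball⟩ := Metric.eventually_nhds_iff.1
    ((hψ.eventually_analyticAt.and (hψc.eventually hh.eventually_analyticAt)).and htgt)
  have hΦc : Filter.Tendsto Φ (𝓝 0) (𝓝 0) := by
    simpa only [hΦ0] using hΦan.continuousAt.tendsto
  filter_upwards [Φ.open_source.mem_nhds hsrc,
    hΦc.eventually (Metric.ball_mem_nhds 0 (half_pos hρ))] with z hz hzρ hGz
  -- the disc `s ↦ Φ⁻¹ (s • Φ z)` lies in the submanifold and passes through `z` at `s = 1`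
  have hx1 : (Φ z).1 = 0 := hGz
  have hnorm : ∀ s ∈ Metric.ball (0 : ℂ) 2, dist (s • Φ z) 0 < ρ := by
    intro s hs
    rw [mem_ball_zero_iff] at hs
    rw [dist_zero_right] at hzρ ⊢
    rw [norm_smul]
    nlinarith [norm_nonneg s, norm_nonneg (Φ z)]
  have hGy : ∀ s ∈ Metric.ball (0 : ℂ) 2, G (Φ.symm (s • Φ z)) = 0 := by
    intro s hs
    have h1 : (Φ (Φ.symm (s • Φ z))).1 = (s • Φ z).1 := by
      rw [Φ.right_inv (hball (hnorm s hs)).2]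
    rw [Prod.smul_fst, hx1, smul_zero] at h1
    exact h1
  have hlin : ∀ s : ℂ, DifferentiableAt ℂ (fun s : ℂ => s • Φ z) s := fun s =>
    differentiableAt_id.smul_const _
  have hydiff : ∀ s ∈ Metric.ball (0 : ℂ) 2,
      DifferentiableAt ℂ (fun s : ℂ => Φ.symm (s • Φ z)) s := fun s hs =>
    (hball (hnorm s hs)).1.1.differentiableAt.comp s (hlin s)
  have hdiff : DifferentiableOn ℂ (fun s : ℂ => h (Φ.symm (s • Φ z))) (Metric.ball 0 2) :=
    fun s hs => ((hball (hnorm s hs)).1.2.differentiableAt.comp s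
      (hydiff s hs)).differentiableWithinAt
  have h0 : (0 : ℂ) ∈ Metric.ball (0 : ℂ) 2 := by simp
  have hyO : (fun s : ℂ => Φ.symm (s • Φ z)) =O[𝓝 0] fun s => ‖s‖ := by
    have := (hydiff 0 h0).isBigO_sub
    simp only [zero_smul, hsymm0, sub_zero] at this
    exact this.norm_right
  have hyt : Filter.Tendsto (fun s : ℂ => Φ.symm (s • Φ z)) (𝓝 0) (𝓝 0) := by
    simpa only [zero_smul, hsymm0] using (hydiff 0 h0).continuousAt.tendsto
  have hres := eq_zero_of_forall_isBigO_pow hdiff fun N => by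
    obtain ⟨a, ha⟩ := hflat N
    refine ((ha.comp_tendsto hyt).trans (hyO.norm_left.pow N)).congr' ?_ Filter.EventuallyEq.rfl
    filter_upwards [Metric.isOpen_ball.mem_nhds h0] with s hs
    simp [hGy s hs]
  rwa [one_smul, Φ.left_inv hz] at hres

/-- If the expansion of `h` is in the formal ideal generated by the expansions of the components
of a submersion `G`, then `h` vanishes on `G = 0`. -/
theorem eventually_eq_zero_of_mem_span {n p : ℕ} {G : (Fin n → ℂ) → Fin p → ℂ}
    {γ : Fin p → MvPowerSeries (Fin n) ℂ} {h : (Fin n → ℂ) → ℂ} {φ : MvPowerSeries (Fin n) ℂ}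
    (hG : AnalyticAt ℂ G 0) (hG0 : G 0 = 0) (hsurj : Function.Surjective (fderiv ℂ G 0))
    (hh : AnalyticAt ℂ h 0) (hγ : ∀ N l, ExpandsTo N (fun z => G z l) (γ l))
    (hφ : ∀ N, ExpandsTo N h φ) (hmem : φ ∈ Ideal.span (Set.range γ)) :
    ∀ᶠ z in 𝓝 0, G z = 0 → h z = 0 := by
  refine eventually_eq_zero_of_flat hG hG0 hsurj hh fun N => ?_
  obtain ⟨c, hc⟩ := Ideal.mem_span_range_iff_exists_fun.1 hmem
  refine ⟨fun l z => MvPolynomial.eval z ((c l).truncTotal N), (hφ N).isBigO_sub ?_⟩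
  rw [← hc]
  refine ExpandsTo.sum fun l _ => ExpandsTo.mul ?_ (hγ N l)
  exact (ExpandsTo.eval N _).congr fun α hα => by
    rw [MvPolynomial.coeff_coe, MvPowerSeries.coeff_truncTotal _ hα]

end Flat

/-! ### Invariant submanifolds -/

namespace FormalMap

variable {n p : ℕ}

theorem Convergent.expandsTo {G : FormalMap n p} (hG : G.Convergent) (N : ℕ) (j : Fin p) :
    ExpandsTo N (fun z => toFun G z j) (G j) :=
  expandsTo_tsum_term (hG j) N

theorem Convergent.analyticAt {G : FormalMap n p} (hG : G.Convergent) :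
    AnalyticAt ℂ (toFun G) 0 := by
  refine AnalyticAt.pi fun j => ?_
  obtain ⟨q, hq, -⟩ := exists_hasFPowerSeriesAt_tsum_term (hG j)
  exact hq.analyticAt

theorem Convergent.toFun_zero {G : FormalMap n p} (hG : G.Convergent)
    (h0 : ∀ j, MvPowerSeries.constantCoeff (G j) = 0) : toFun G 0 = 0 :=
  funext fun j => ((hG.expandsTo 1 j).apply_zero).trans (h0 j)

end FormalMap

/-- The linear map given by the linear part of a formal map is the derivative of every map which
expands to it. -/
theorem hasFDerivAt_of_expandsTo {n p : ℕ} {G : (Fin n → ℂ) → Fin p → ℂ} {γ : FormalMap n p}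
    (h : ∀ j, ExpandsTo 2 (fun z => G z j) (γ j)) :
    HasFDerivAt G (Matrix.mulVecLin (FormalMap.linearPart γ)).toContinuousLinearMap 0 := by
  rw [hasFDerivAt_pi']
  intro j
  refine (h j).hasFDerivAt.congr_fderiv (ContinuousLinearMap.ext fun z => ?_)
  simp [FormalMap.linearPart, Matrix.mulVec, dotProduct]

theorem surjective_mulVecLin_of_rank_eq {n p : ℕ} {L : Matrix (Fin p) (Fin n) ℂ}
    (h : L.rank = p) : Function.Surjective L.mulVecLin := by
  rw [← LinearMap.range_eq_top]
  apply Submodule.eq_top_of_finrank_eq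
  rw [Module.finrank_fin_fun]
  exact h

theorem isUnit_det_of_rank_eq {p : ℕ} {M : Matrix (Fin p) (Fin p) ℂ} (h : M.rank = p) :
    IsUnit M.det := by
  rw [← Matrix.isUnit_iff_isUnit_det, ← Matrix.mulVec_surjective_iff_isUnit]
  exact surjective_mulVecLin_of_rank_eq h

theorem MvPowerSeries.coeff_single_one_mul {n : ℕ} (φ ψ : MvPowerSeries (Fin n) ℂ) (k : Fin n) :
    coeff (Finsupp.single k 1) (φ * ψ) =
      constantCoeff φ * coeff (Finsupp.single k 1) ψ +
        coeff (Finsupp.single k 1) φ * constantCoeff ψ := by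
  classical
  rw [coeff_mul, Finsupp.antidiagonal_single, Finset.sum_map, Finset.Nat.antidiagonal_succ]
  simp

namespace FormalMap

variable {n p : ℕ}

/-- If the components of `H` are combinations of those of `G`, which vanish at `0`, and the linear
part of `H` has rank `p`, then the matrix of the combination is invertible, as its constant term is;
hence the components of `G` are combinations of those of `H`. -/
theorem mem_span_range_of_rank {G H : FormalMap n p}
    (hG : ∀ j, MvPowerSeries.constantCoeff (G j) = 0) (hH : (linearPart H).rank = p)
    (hmem : ∀ j, H j ∈ Ideal.span (Set.range G)) (j : Fin p) :
    G j ∈ Ideal.span (Set.range H) := by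
  choose M hM using fun j => Ideal.mem_span_range_iff_exists_fun.1 (hmem j)
  let M' : Matrix (Fin p) (Fin p) (MvPowerSeries (Fin n) ℂ) := Matrix.of M
  have hlin : linearPart H = M'.map MvPowerSeries.constantCoeff * linearPart G := by
    ext i k
    simp only [linearPart, Matrix.of_apply, Matrix.mul_apply, Matrix.map_apply, M', ← hM i,
      map_sum, MvPowerSeries.coeff_single_one_mul, hG, mul_zero, add_zero]
  have hrank : (M'.map MvPowerSeries.constantCoeff).rank = p := by
    refine le_antisymm ((Matrix.rank_le_width _)) ?_
    have := Matrix.rank_mul_le_left (M'.map MvPowerSeries.constantCoeff) (linearPart G)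
    rwa [← hlin, hH] at this
  have hunit : IsUnit M'.det := by
    rw [MvPowerSeries.isUnit_iff_constantCoeff, RingHom.map_det]
    exact isUnit_det_of_rank_eq hrank
  have hMG : M'.mulVec G = H := funext fun i => by
    rw [← hM i]; rfl
  have hinv : M'⁻¹.mulVec H = G := by
    rw [← hMG, Matrix.mulVec_mulVec, Matrix.nonsing_inv_mul _ hunit, Matrix.one_mulVec]
  rw [← congrFun hinv j]
  have hsum : ∑ l, M'⁻¹ j l * H l ∈ Ideal.span (Set.range H) :=
    Ideal.sum_mem _ fun l _ => Ideal.mul_mem_left _ _ (Ideal.subset_span (Set.mem_range_self l))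
  exact hsum

/-- For convergent data, a formal invariant submanifold of a germ of diffeomorphism is an
invariant submanifold. -/
theorem IsFormalInvariantSubmanifold.isInvariantSubmanifold {g : FormalMap n n}
    {G : FormalMap n p} (h : IsFormalInvariantSubmanifold g G) (hg : g.Convergent)
    (hg0 : ∀ j, MvPowerSeries.constantCoeff (g j) = 0) (hgA : IsUnit (linearPart g).det)
    (hG : G.Convergent) : IsInvariantSubmanifold g G := by
  have hGan := hG.analyticAt
  have hG0 := hG.toFun_zero h.zero
  have hg0' := hg.toFun_zero hg0
  have hGd := hasFDerivAt_of_expandsTo (hG.expandsTo 2)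
  have hgd := hasFDerivAt_of_expandsTo (hg.expandsTo 2)
  let η : FormalMap n p := fun j => MvPowerSeries.subst g (G j)
  let H : (Fin n → ℂ) → Fin p → ℂ := fun z => toFun G (toFun g z)
  have hη : ∀ N j, ExpandsTo N (fun z => H z j) (η j) := fun N j =>
    (hG.expandsTo N j).comp (hg.expandsTo N) (hg.expandsTo 1) hg0
  have hHan : AnalyticAt ℂ H 0 :=
    AnalyticAt.comp (f := toFun g) (g := toFun G) (by rwa [hg0']) hg.analyticAt
  have hH0 : H 0 = 0 := by simp only [H, hg0', hG0]
  have hHd := hasFDerivAt_of_expandsTo (hη 2)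
  have hHd' : HasFDerivAt H _ 0 :=
    HasFDerivAt.comp (f := toFun g) (g := toFun G) 0 (by rw [hg0']; exact hGd) hgd
  have hlin : linearPart η = linearPart G * linearPart g := by
    refine Matrix.toLin'.injective (LinearMap.ext fun z => ?_)
    rw [Matrix.toLin'_mul]
    exact congrArg (fun T : (Fin n → ℂ) →L[ℂ] Fin p → ℂ => T z) (hHd.unique hHd')
  have hrank : (linearPart η).rank = p := by
    rw [hlin, Matrix.rank_mul_eq_left_of_isUnit_det _ _ hgA, h.rank]
  have hGs : Function.Surjective (fderiv ℂ (toFun G) 0) := by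
    rw [hGd.fderiv]; exact surjective_mulVecLin_of_rank_eq h.rank
  have hHs : Function.Surjective (fderiv ℂ H 0) := by
    rw [hHd.fderiv]; exact surjective_mulVecLin_of_rank_eq hrank
  refine ⟨hGan, hG0, hGs, ?_⟩
  have h1 : ∀ᶠ z in 𝓝 0, ∀ j, toFun G z = 0 → H z j = 0 := Filter.eventually_all.2 fun j =>
    eventually_eq_zero_of_mem_span hGan hG0 hGs (analyticAt_pi_iff.1 hHan j) hG.expandsTo
      (fun N => hη N j) (h.invariant j)
  have h2 : ∀ᶠ z in 𝓝 0, ∀ j, H z = 0 → toFun G z j = 0 := Filter.eventually_all.2 fun j =>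
    eventually_eq_zero_of_mem_span hHan hH0 hHs (analyticAt_pi_iff.1 hGan j) hη
      (fun N => hG.expandsTo N j) (mem_span_range_of_rank h.zero hrank h.invariant j)
  filter_upwards [h1, h2] with z hz1 hz2
  exact ⟨fun hz => funext fun j => hz2 j hz, fun hz => funext fun j => hz1 j hz⟩

theorem term_add (φ ψ : MvPowerSeries (Fin n) ℂ) (z : Fin n → ℂ) :
    term (φ + ψ) z = term φ z + term ψ z := by
  ext α; simp [term, add_mul]

theorem term_smul (c : ℂ) (φ : MvPowerSeries (Fin n) ℂ) (z : Fin n → ℂ) :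
    term (c • φ) z = fun α => c * term φ z α := by
  ext α; simp [term, mul_assoc]

theorem eventually_summable_term_sum {ι : Type*} {s : Finset ι}
    {φ : ι → MvPowerSeries (Fin n) ℂ}
    (h : ∀ i ∈ s, ∀ᶠ z in 𝓝 (0 : Fin n → ℂ), Summable (term (φ i) z)) :
    ∀ᶠ z in 𝓝 (0 : Fin n → ℂ), Summable (term (∑ i ∈ s, φ i) z) := by
  filter_upwards [(Filter.eventually_all_finset s).2 h] with z hz
  refine (summable_sum hz).congr fun α => ?_
  simp [term, Finset.sum_mul]

theorem summable_term_X (k : Fin n) (z : Fin n → ℂ) :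
    Summable (term (MvPowerSeries.X k) z) := by
  classical
  refine summable_of_ne_finset_zero (s := {Finsupp.single k 1}) fun α hα => ?_
  rw [Finset.mem_singleton] at hα
  simp [term, MvPowerSeries.coeff_X, hα]

end FormalMap

section PolyFamily

variable {n m : ℕ} {A : Matrix (Fin n) (Fin n) ℂ} {d : ℕ} {f : (Fin m → ℕ) → FormalMap n n}

theorem polyFamily_convergent (hf : ∀ i, ∑ k, i k ≤ d → (f i).Convergent) (t : Fin m → ℂ) :
    (polyFamily A d f t).Convergent := by
  intro j
  have h1 : ∀ᶠ z in 𝓝 (0 : Fin n → ℂ), Summable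
      (FormalMap.term (∑ k, A j k • MvPowerSeries.X k) z) :=
    FormalMap.eventually_summable_term_sum fun k _ => Filter.Eventually.of_forall fun z => by
      rw [FormalMap.term_smul]
      exact (FormalMap.summable_term_X k z).mul_left _
  have h2 : ∀ᶠ z in 𝓝 (0 : Fin n → ℂ), Summable
      (FormalMap.term (∑ l ∈ Finset.range (d + 1), ∑ i ∈ Finset.piAntidiag Finset.univ l,
        (∏ k, t k ^ i k) • f i j) z) :=
    FormalMap.eventually_summable_term_sum fun l hl =>
      FormalMap.eventually_summable_term_sum fun i hi => by
        have hi' : ∑ k, i k ≤ d := by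
          rw [(Finset.mem_piAntidiag.1 hi).1]
          exact Nat.lt_succ_iff.1 (Finset.mem_range.1 hl)
        filter_upwards [hf i hi' j] with z hz
        rw [FormalMap.term_smul]
        exact hz.mul_left _
  filter_upwards [h1, h2] with z hz1 hz2
  rw [polyFamily, FormalMap.term_add]
  exact hz1.add hz2

theorem coeff_polyFamily (hf : ∀ i, ∑ k, i k ≤ d → (f i).ValuationGE 2) (t : Fin m → ℂ)
    (j : Fin n) {α : Fin n →₀ ℕ} (hα : α.degree < 2) :
    MvPowerSeries.coeff α (polyFamily A d f t j) =
      ∑ k, A j k * MvPowerSeries.coeff α (MvPowerSeries.X k : MvPowerSeries (Fin n) ℂ) := by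
  simp only [polyFamily, map_add, map_sum, map_smul, smul_eq_mul]
  rw [add_eq_left]
  refine Finset.sum_eq_zero fun l hl => Finset.sum_eq_zero fun i hi => ?_
  have hi' : ∑ k, i k ≤ d := by
    rw [(Finset.mem_piAntidiag.1 hi).1]
    exact Nat.lt_succ_iff.1 (Finset.mem_range.1 hl)
  rw [hf i hi' j α hα, mul_zero]

theorem constantCoeff_polyFamily (hf : ∀ i, ∑ k, i k ≤ d → (f i).ValuationGE 2)
    (t : Fin m → ℂ) (j : Fin n) :
    MvPowerSeries.constantCoeff (polyFamily A d f t j) = 0 := by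
  rw [← MvPowerSeries.coeff_zero_eq_constantCoeff_apply, coeff_polyFamily hf t j (by simp)]
  simp

theorem linearPart_polyFamily (hf : ∀ i, ∑ k, i k ≤ d → (f i).ValuationGE 2) (t : Fin m → ℂ) :
    FormalMap.linearPart (polyFamily A d f t) = A := by
  classical
  ext j k
  rw [FormalMap.linearPart, Matrix.of_apply, coeff_polyFamily hf t j (by simp)]
  simp [MvPowerSeries.coeff_X, Finsupp.single_left_inj]

end PolyFamily

theorem setOf_convergent_eq_geometricGrowthSet {n m p : ℕ}
    (F : Fin p → MvPowerSeries (Fin n) (MvPolynomial (Fin m) ℂ)) :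
    {t | (specialize F t).Convergent} =
      geometricGrowthSet (fun a : Fin p × (Fin n →₀ ℕ) => MvPowerSeries.coeff a.2 (F a.1))
        fun a => a.2.degree := by
  ext t
  have hcoeff : ∀ j α, MvPowerSeries.coeff α (specialize F t j) =
      MvPolynomial.eval t (MvPowerSeries.coeff α (F j)) := fun j α => by
    simp [specialize]
  constructor
  · intro h
    choose R hR using fun j => FormalMap.eventually_summable_term_iff.1 (h j)
    refine ⟨∑ j, |R j|, fun a => ?_⟩
    rw [← hcoeff]
    refine (hR a.1 a.2).trans (((le_abs_self _).trans_eq (abs_pow _ _)).trans ?_)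
    gcongr
    exact Finset.single_le_sum (f := fun j => |R j|) (fun _ _ => abs_nonneg _)
      (Finset.mem_univ a.1)
  · rintro ⟨R, hR⟩ j
    exact FormalMap.eventually_summable_term_iff.2 ⟨R, fun α => by
      rw [hcoeff]; exact hR (j, α)⟩

theorem theorem3 (n m p d : ℕ) (hn : 1 ≤ n) (hm : 1 ≤ m)
    (A : Matrix (Fin n) (Fin n) ℂ) (hA : IsUnit A.det) (hres : NonResonant A)
    (f : (Fin m → ℕ) → FormalMap n n)
    (hf : ∀ i, ∑ k, i k ≤ d → (f i).Convergent ∧ (f i).ValuationGE 2)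
    (F : Fin p → MvPowerSeries (Fin n) (MvPolynomial (Fin m) ℂ))
    (C₀ C₁ : ℝ) (hC₀ : 0 < C₀) (hC₁ : 0 < C₁)
    (hdeg : ∀ (j : Fin p) (α : Fin n →₀ ℕ),
      ((MvPowerSeries.coeff α (F j)).totalDegree : ℝ) < C₀ + C₁ * (α.degree : ℝ))
    (hinv : ∀ t, FormalMap.IsFormalInvariantSubmanifold (polyFamily A d f t) (specialize F t)) :
    ((∀ t, (specialize F t).Convergent ∧
        FormalMap.IsInvariantSubmanifold (polyFamily A d f t) (specialize F t)) ∨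
      gammaCapacity {t | (specialize F t).Convergent} = 0) ∧
    ¬ ((∀ t, (specialize F t).Convergent ∧
        FormalMap.IsInvariantSubmanifold (polyFamily A d f t) (specialize F t)) ∧
      gammaCapacity {t | (specialize F t).Convergent} = 0) := by
  constructor
  · rw [or_iff_not_imp_right]
    intro hcap t
    have huniv : {t | (specialize F t).Convergent} = Set.univ := by
      rw [setOf_convergent_eq_geometricGrowthSet] at hcap ⊢
      refine geometricGrowthSet_eq_univ_of_gammaCapacity _ _ ⌈C₀ + C₁⌉₊ (fun a => ?_) hcap
      have h1 := hdeg a.1 a.2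
      have h2 := Nat.le_ceil (C₀ + C₁)
      have h3 : (0 : ℝ) ≤ a.2.degree := Nat.cast_nonneg _
      rw [← Nat.cast_le (α := ℝ)]
      push_cast
      nlinarith
    have ht : (specialize F t).Convergent := huniv.ge (Set.mem_univ t)
    have hval := fun i hi => (hf i hi).2
    exact ⟨ht, (hinv t).isInvariantSubmanifold (polyFamily_convergent (fun i hi => (hf i hi).1) t)
      (constantCoeff_polyFamily hval t) (by rwa [linearPart_polyFamily hval t]) ht⟩
  · rintro ⟨hall, hcap⟩
    have huniv : {t | (specialize F t).Convergent} = Set.univ :=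
      Set.eq_univ_of_forall fun t => (hall t).1
    rw [huniv] at hcap
    exact gammaCapacity_univ_ne_zero hm hcap
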